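/- **Theorem 3.11 (with its corollary on regularity).** Let $F$ be a (complex) operator space, i.e. a complex normed space with norms on all $M_n(F)$ satisfying Ruan's axioms, and let $F^*$ be its dual operator space, $M_n(F^*)=CB(F,M_n)$. Call $F$ *$\lambda$-homogeneous* if every bounded linear $T:F\to F$ is completely bounded with $\|T\|_{cb}\le\lambda\|T\|$, and *$\lambda$-Hilbertian* if there is an isomorphism $T$ from a Hilbert space onto $F$ with $\|T\|\,\|T^{-1}\|\le\lambda$; call $F$ homogeneous (Hilbertian) if this holds for some $\lambda$. For a system $e=(e_k)_{1\le k\le \dim F}$ in $F$ (a sequence $(e_k)_{k\ge 1}$ if $\dim F=\infty$) which is the image of an orthonormal system under an isomorphism from a Hilbert space onto $F$, put $$\Phi_{c,F}(n)=\Big\|\sum_{k=1}^n e_{k1}\otimes e_k\Big\|^2_{C\otimes_{\min}F},\qquad \Phi_{r,F}(n)=\Big\|\sum_{k=1}^n e_{1k}\otimes e_k\Big\|^2_{R\otimes_{\min}F}\qquad(n\in\mathbb N,\ n\le\dim F),$$ where $C$ and $R$ are the column and row subspaces of $B(\ell_2)$ and $e_{ij}$ are the matrix units. Call $F$ *regular*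 if, for such a system, there are constants $c,d>0$ and $0<\alpha\le\beta<1$ such that for $\Phi=\Phi_{c,F}$ and for $\Phi=\Phi_{r,F}$ $$c\,(n/k)^\alpha\le \Phi(n)/\Phi(k)\le d\,(n/k)^\beta\qquad\text{for all } n\ge k\ge 1,\ n\le\dim F .$$ (i) If $F$ is $1$-homogeneous and $1$-Hilbertian, then, for the fundamental functions taken with respect to arbitrary orthonormal systems of $F$ and of $F^*$ (images of orthonormal systems under surjective isometries from Hilbert spaces), $$\Phi_{c,F}(n)\,\Phi_{c,F^*}(n)=n\quad\text{and}\quad \Phi_{r,F}(n)\,\Phi_{r,F^*}(n)=n\qquad\text{for all } n\in\mathbb N,\ n\le\dim F.$$ (ii) If $F$ is homogeneous and Hilbertian (in particular, if $F$ is as in (i)), then $F$ is regular if and only if $F^*$ is regular. -/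

import Mathlib

open scoped Matrix.Norms.L2Operator

/-! Scalar matrices carry the operator norm between the Euclidean spaces `ℂⁿ` throughout. -/

noncomputable section

namespace OpSpace

universe u

/-! ## Operator spaces -/

/-- The product `α x β` of an `F`-valued matrix `x` with scalar matrices `α`, `β`. -/
def sandwich {F : Type*} [AddCommGroup F] [Module ℂ F] {m n : ℕ}
    (α : Matrix (Fin n) (Fin m) ℂ) (x : Matrix (Fin m) (Fin m) F)
    (β : Matrix (Fin m) (Fin n) ℂ) : Matrix (Fin n) (Fin n) F :=
  Matrix.of fun i j => ∑ k, ∑ l, (α i k * β l j) • x k l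

/-- The block diagonal matrix `x ⊕ y ∈ M_{m+n}(F)`. -/
def directSum {F : Type*} [Zero F] {m n : ℕ}
    (x : Matrix (Fin m) (Fin m) F) (y : Matrix (Fin n) (Fin n) F) :
    Matrix (Fin (m + n)) (Fin (m + n)) F :=
  Matrix.reindex finSumFinEquiv finSumFinEquiv (Matrix.fromBlocks x 0 0 y)

/-- An operator space structure on a complex normed space `F` in the sense of Ruan: norms on all
the spaces `M_n(F)`, extending the norm of `F = M_1(F)`, such that
`‖x ⊕ y‖ = max ‖x‖ ‖y‖` and `‖α x β‖ ≤ ‖α‖ ‖x‖ ‖β‖` for scalar matrices `α`, `β`.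
(Definiteness of the norms on `M_n(F)` follows from the last axiom and the case `n = 1`.) -/
class OperatorSpace (F : Type*) [NormedAddCommGroup F] [NormedSpace ℂ F] where
  /-- The norm of `M_n(F)`. -/
  matNorm : ∀ n : ℕ, Seminorm ℂ (Matrix (Fin n) (Fin n) F)
  matNorm_one : ∀ v : F, matNorm 1 (Matrix.of fun _ _ => v) = ‖v‖
  matNorm_directSum : ∀ {m n : ℕ} (x : Matrix (Fin m) (Fin m) F) (y : Matrix (Fin n) (Fin n) F),
    matNorm (m + n) (directSum x y) = max (matNorm m x) (matNorm n y)
  matNorm_sandwich : ∀ {m n : ℕ} (α : Matrix (Fin n) (Fin m) ℂ) (x : Matrix (Fin m) (Fin m) F)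
    (β : Matrix (Fin m) (Fin n) ℂ), matNorm n (sandwich α x β) ≤ ‖α‖ * matNorm m x * ‖β‖

open OperatorSpace

/-! ## The dual operator space -/

/-- For `f ∈ M_n(F*)` and `x ∈ M_m(F)`, the scalar matrix `(f_{ij}(x_{kl}))` in `M_n(M_m)`; this
is the image of `x` under the `m`-th amplification of the map `F → M_n`, `v ↦ (f_{ij}(v))`. -/
def pairing {F : Type*} [NormedAddCommGroup F] [NormedSpace ℂ F] {n m : ℕ}
    (f : Matrix (Fin n) (Fin n) (StrongDual ℂ F)) (x : Matrix (Fin m) (Fin m) F) :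
    Matrix (Fin n × Fin m) (Fin n × Fin m) ℂ :=
  Matrix.of fun p q => f p.1 q.1 (x p.2 q.2)

/-- The numbers `K ≥ 0` such that the map `F → M_n`, `v ↦ (f_{ij}(v))`, is completely bounded with
constant `K`. -/
def cbBounds {F : Type*} [NormedAddCommGroup F] [NormedSpace ℂ F] [OperatorSpace F] {n : ℕ}
    (f : Matrix (Fin n) (Fin n) (StrongDual ℂ F)) : Set ℝ :=
  {K | 0 ≤ K ∧ ∀ (m : ℕ) (x : Matrix (Fin m) (Fin m) F), ‖pairing f x‖ ≤ K * matNorm m x}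

/-- The norm of `M_n(F*) = CB(F, M_n)`: the completely bounded norm of `v ↦ (f_{ij}(v))`. -/
def dualNorm {F : Type*} [NormedAddCommGroup F] [NormedSpace ℂ F] [OperatorSpace F] {n : ℕ}
    (f : Matrix (Fin n) (Fin n) (StrongDual ℂ F)) : ℝ :=
  sInf (cbBounds f)

section facts

open Matrix

theorem norm_le_of_sq {ι κ : Type*} [Fintype ι] [Fintype κ] [DecidableEq κ]
    (A : Matrix ι κ ℂ) {K : ℝ} (hK : 0 ≤ K)
    (h : ∀ v : κ → ℂ, ∑ i, ‖(A *ᵥ v) i‖ ^ 2 ≤ K ^ 2 * ∑ j, ‖v j‖ ^ 2) : ‖A‖ ≤ K := by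
  rw [Matrix.l2_opNorm_def]
  refine ContinuousLinearMap.opNorm_le_bound _ hK fun v => ?_
  refine (sq_le_sq₀ (norm_nonneg _) (by positivity)).1 ?_
  rw [mul_pow, EuclideanSpace.norm_sq_eq, EuclideanSpace.norm_sq_eq]
  exact h v.ofLp

theorem sq_le_norm {ι κ : Type*} [Fintype ι] [Fintype κ] [DecidableEq κ]
    (A : Matrix ι κ ℂ) (v : κ → ℂ) :
    ∑ i, ‖(A *ᵥ v) i‖ ^ 2 ≤ ‖A‖ ^ 2 * ∑ j, ‖v j‖ ^ 2 := by
  have h := Matrix.l2_opNorm_mulVec A (WithLp.toLp 2 v)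
  have h2 := pow_le_pow_left₀ (norm_nonneg _) h 2
  rw [mul_pow, EuclideanSpace.norm_sq_eq, EuclideanSpace.norm_sq_eq] at h2
  exact h2

/-- `α ⊗ 1`. -/
def amp {a b : ℕ} (m : ℕ) (α : Matrix (Fin a) (Fin b) ℂ) :
    Matrix (Fin a × Fin m) (Fin b × Fin m) ℂ :=
  Matrix.of fun p q => if p.2 = q.2 then α p.1 q.1 else 0

theorem norm_amp_le {a b : ℕ} (m : ℕ) (α : Matrix (Fin a) (Fin b) ℂ) : ‖amp m α‖ ≤ ‖α‖ := by
  refine norm_le_of_sq _ (norm_nonneg _) fun v => ?_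
  have key : ∀ i k, (amp m α *ᵥ v) (i, k) = (α *ᵥ fun j => v (j, k)) i := by
    intro i k
    simp [amp, mulVec, dotProduct, Fintype.sum_prod_type, ite_mul]
  rw [Fintype.sum_prod_type_right, Fintype.sum_prod_type_right, Finset.mul_sum]
  refine Finset.sum_le_sum fun k _ => ?_
  simp only [key]
  exact sq_le_norm α _

variable {F : Type*} [NormedAddCommGroup F] [NormedSpace ℂ F]

theorem pairing_sandwich {n a m : ℕ} (α : Matrix (Fin a) (Fin n) ℂ)
    (f : Matrix (Fin n) (Fin n) (StrongDual ℂ F)) (β : Matrix (Fin n) (Fin a) ℂ)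
    (x : Matrix (Fin m) (Fin m) F) :
    pairing (sandwich α f β) x = amp m α * pairing f x * amp m β := by
  ext ⟨i, k⟩ ⟨j, l⟩
  simp only [pairing, sandwich, amp, Matrix.mul_apply, Matrix.of_apply, Fintype.sum_prod_type,
    ite_mul, zero_mul, mul_ite, mul_zero, Finset.sum_ite_eq, Finset.sum_ite_eq',
    Finset.mem_univ, if_true, _root_.sum_apply, _root_.smul_apply,
    smul_eq_mul, Finset.sum_mul]
  rw [Finset.sum_comm]
  refine Finset.sum_congr rfl fun _ _ => Finset.sum_congr rfl fun _ _ => ?_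
  ring

theorem pairing_add {n m : ℕ} (f g : Matrix (Fin n) (Fin n) (StrongDual ℂ F))
    (x : Matrix (Fin m) (Fin m) F) : pairing (f + g) x = pairing f x + pairing g x := by
  ext; simp [pairing]

theorem pairing_smul {n m : ℕ} (c : ℂ) (f : Matrix (Fin n) (Fin n) (StrongDual ℂ F))
    (x : Matrix (Fin m) (Fin m) F) : pairing (c • f) x = c • pairing f x := by
  ext; simp [pairing]

theorem pairing_directSum_sq {a b m : ℕ} (f : Matrix (Fin a) (Fin a) (StrongDual ℂ F))
    (g : Matrix (Fin b) (Fin b) (StrongDual ℂ F)) (x : Matrix (Fin m) (Fin m) F)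
    {K : ℝ} (hf : ‖pairing f x‖ ≤ K) (hg : ‖pairing g x‖ ≤ K) :
    ‖pairing (directSum f g) x‖ ≤ K := by
  have hK : 0 ≤ K := (norm_nonneg _).trans hf
  refine norm_le_of_sq _ hK fun v => ?_
  have e1 : ∀ i k, (pairing (directSum f g) x *ᵥ v) (Fin.castAdd b i, k) =
      (pairing f x *ᵥ fun p => v (Fin.castAdd b p.1, p.2)) (i, k) := by
    intro i k
    simp [pairing, directSum, mulVec, dotProduct, Fintype.sum_prod_type, Fin.sum_univ_add]
  have e2 : ∀ i k, (pairing (directSum f g) x *ᵥ v) (Fin.natAdd a i, k) =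
      (pairing g x *ᵥ fun p => v (Fin.natAdd a p.1, p.2)) (i, k) := by
    intro i k
    simp [pairing, directSum, mulVec, dotProduct, Fintype.sum_prod_type, Fin.sum_univ_add]
  have h1 := (sq_le_norm (pairing f x) fun p => v (Fin.castAdd b p.1, p.2)).trans
    (mul_le_mul_of_nonneg_right (pow_le_pow_left₀ (norm_nonneg _) hf 2)
      (Finset.sum_nonneg fun _ _ => by positivity))
  have h2 := (sq_le_norm (pairing g x) fun p => v (Fin.natAdd a p.1, p.2)).trans
    (mul_le_mul_of_nonneg_right (pow_le_pow_left₀ (norm_nonneg _) hg 2)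
      (Finset.sum_nonneg fun _ _ => by positivity))
  rw [Fintype.sum_prod_type, Fintype.sum_prod_type, Fin.sum_univ_add, Fin.sum_univ_add, mul_add]
  rw [Fintype.sum_prod_type, Fintype.sum_prod_type] at h1 h2
  simp only [e1, e2]
  exact add_le_add h1 h2

theorem sandwich_select {G : Type*} [AddCommGroup G] [Module ℂ G] {a b : ℕ} (σ : Fin a → Fin b)
    (x : Matrix (Fin b) (Fin b) G) :
    sandwich (Matrix.of fun i k => if k = σ i then 1 else 0) x
      (Matrix.of fun l j => if l = σ j then 1 else 0) = Matrix.of fun i j => x (σ i) (σ j) := by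
  refine Matrix.ext fun i j => ?_
  simp only [sandwich, Matrix.of_apply, mul_ite, mul_one, mul_zero, ite_smul, one_smul,
    zero_smul ℂ, Finset.sum_ite_eq', Finset.mem_univ, if_true]

theorem sandwich_left {a b : ℕ} (f : Matrix (Fin a) (Fin a) (StrongDual ℂ F))
    (g : Matrix (Fin b) (Fin b) (StrongDual ℂ F)) :
    sandwich (Matrix.of fun i k => if k = Fin.castAdd b i then 1 else 0) (directSum f g)
      (Matrix.of fun l j => if l = Fin.castAdd b j then 1 else 0) = f := by
  rw [sandwich_select]
  refine Matrix.ext fun i j => ?_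
  simp [directSum]

theorem sandwich_right {a b : ℕ} (f : Matrix (Fin a) (Fin a) (StrongDual ℂ F))
    (g : Matrix (Fin b) (Fin b) (StrongDual ℂ F)) :
    sandwich (Matrix.of fun i k => if k = Fin.natAdd a i then 1 else 0) (directSum f g)
      (Matrix.of fun l j => if l = Fin.natAdd a j then 1 else 0) = g := by
  rw [sandwich_select]
  refine Matrix.ext fun i j => ?_
  simp [directSum]

variable [OperatorSpace F]

/-- A bounded functional is completely bounded with the same norm. -/
theorem norm_map_le (φ : StrongDual ℂ F) {m : ℕ} (x : Matrix (Fin m) (Fin m) F) :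
    ‖(Matrix.of fun k l => φ (x k l) : Matrix (Fin m) (Fin m) ℂ)‖ ≤ ‖φ‖ * matNorm m x := by
  set A : Matrix (Fin m) (Fin m) ℂ := Matrix.of fun k l => φ (x k l) with hA
  have hN : 0 ≤ matNorm m x := apply_nonneg _ _
  refine norm_le_of_sq _ (by positivity) fun v => ?_
  set y := A *ᵥ v with hy
  set S := ∑ i, ‖y i‖ ^ 2 with hS
  set V := ∑ j, ‖v j‖ ^ 2 with hV
  have hS0 : 0 ≤ S := Finset.sum_nonneg fun _ _ => by positivity
  have hV0 : 0 ≤ V := Finset.sum_nonneg fun _ _ => by positivity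
  let r : Matrix (Fin 1) (Fin m) ℂ := Matrix.of fun _ k => star (y k)
  let c : Matrix (Fin m) (Fin 1) ℂ := Matrix.of fun l _ => v l
  have hcol : ∀ w : Fin m → ℂ, ‖(Matrix.of fun l _ => w l : Matrix (Fin m) (Fin 1) ℂ)‖ ≤
      Real.sqrt (∑ j, ‖w j‖ ^ 2) := by
    intro w
    refine norm_le_of_sq _ (Real.sqrt_nonneg _) fun t => ?_
    rw [Real.sq_sqrt (Finset.sum_nonneg fun _ _ => by positivity)]
    simp [mulVec, dotProduct, mul_pow, Finset.sum_mul]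
  have hc : ‖c‖ ≤ Real.sqrt V := hcol v
  have hr : ‖r‖ ≤ Real.sqrt S := by
    have : r = (Matrix.of fun l _ => y l : Matrix (Fin m) (Fin 1) ℂ)ᴴ := by
      ext; simp [r]
    rw [this, Matrix.l2_opNorm_conjTranspose]
    exact hcol y
  have h1 := matNorm_sandwich r x c
  set z : F := ∑ k, ∑ l, (star (y k) * v l) • x k l with hz
  have h2 : sandwich r x c = Matrix.of fun _ _ => z := by
    ext; simp [sandwich, r, c, hz]
  rw [h2, matNorm_one] at h1
  have h3 : φ z = (S : ℂ) := by
    rw [hz, hS]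
    push_cast
    simp only [map_sum, map_smul, smul_eq_mul]
    refine Finset.sum_congr rfl fun k _ => ?_
    rw [← Complex.conj_mul']
    simp only [hy, mulVec, dotProduct, Finset.mul_sum, hA, Matrix.of_apply]
    refine Finset.sum_congr rfl fun l _ => ?_
    simp only [starRingEnd_apply]
    ring
  have h4 : S ≤ ‖φ‖ * matNorm m x * (Real.sqrt S * Real.sqrt V) := by
    calc S = ‖φ z‖ := by rw [h3, Complex.norm_real, Real.norm_of_nonneg hS0]
      _ ≤ ‖φ‖ * ‖z‖ := φ.le_opNorm z
      _ ≤ ‖φ‖ * (Real.sqrt S * matNorm m x * Real.sqrt V) := by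
        gcongr
        exact h1.trans (by gcongr)
      _ = _ := by ring
  have hs := Real.sq_sqrt hS0
  have hv := Real.sq_sqrt hV0
  rcases eq_or_lt_of_le (Real.sqrt_nonneg S) with h0 | h0
  · rw [← hs, ← h0, zero_pow two_ne_zero]; exact mul_nonneg (sq_nonneg _) hV0
  · have h5 : Real.sqrt S ≤ ‖φ‖ * matNorm m x * Real.sqrt V := by
      refine le_of_mul_le_mul_left ?_ h0
      nlinarith
    calc S = Real.sqrt S ^ 2 := hs.symm
      _ ≤ (‖φ‖ * matNorm m x * Real.sqrt V) ^ 2 := by gcongr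
      _ = (‖φ‖ * matNorm m x) ^ 2 * V := by rw [mul_pow, hv]

theorem pairing_one (φ : StrongDual ℂ F) {m : ℕ} (x : Matrix (Fin m) (Fin m) F) :
    ‖pairing (n := 1) (Matrix.of fun _ _ => φ) x‖ ≤ ‖φ‖ * matNorm m x := by
  refine (norm_le_of_sq _ (norm_nonneg _) fun v => ?_).trans (norm_map_le φ x)
  have e : ∀ k, (pairing (n := 1) (Matrix.of fun _ _ => φ) x *ᵥ v) (0, k) =
      ((Matrix.of fun k l => φ (x k l) : Matrix (Fin m) (Fin m) ℂ) *ᵥ fun l => v (0, l)) k := by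
    intro k
    simp [pairing, mulVec, dotProduct, Fintype.sum_prod_type]
  have h := sq_le_norm (Matrix.of fun k l => φ (x k l) : Matrix (Fin m) (Fin m) ℂ)
    fun l => v (0, l)
  simpa only [Fintype.sum_prod_type, Fin.sum_univ_one, Fin.isValue, e] using h

theorem cbBounds_bddBelow {n : ℕ} (f : Matrix (Fin n) (Fin n) (StrongDual ℂ F)) :
    BddBelow (cbBounds f) := ⟨0, fun _ h => h.1⟩

theorem cbBounds_sandwich {n a : ℕ} (α : Matrix (Fin a) (Fin n) ℂ)
    {f : Matrix (Fin n) (Fin n) (StrongDual ℂ F)} (β : Matrix (Fin n) (Fin a) ℂ) {K : ℝ}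
    (hK : K ∈ cbBounds f) : ‖α‖ * K * ‖β‖ ∈ cbBounds (sandwich α f β) := by
  have h0 := hK.1
  refine ⟨by positivity, fun m x => ?_⟩
  rw [pairing_sandwich]
  have hN : 0 ≤ matNorm m x := apply_nonneg _ _
  calc _ ≤ ‖amp m α‖ * ‖pairing f x‖ * ‖amp m β‖ :=
        (Matrix.l2_opNorm_mul _ _).trans
          (mul_le_mul_of_nonneg_right (Matrix.l2_opNorm_mul _ _) (norm_nonneg _))
    _ ≤ ‖α‖ * (K * matNorm m x) * ‖β‖ := by
        gcongr
        · exact norm_amp_le m α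
        · exact hK.2 m x
        · exact norm_amp_le m β
    _ = _ := by ring

theorem cbBounds_add {n : ℕ} {f g : Matrix (Fin n) (Fin n) (StrongDual ℂ F)} {K L : ℝ}
    (hK : K ∈ cbBounds f) (hL : L ∈ cbBounds g) : K + L ∈ cbBounds (f + g) := by
  refine ⟨add_nonneg hK.1 hL.1, fun m x => ?_⟩
  rw [pairing_add, add_mul]
  exact (norm_add_le _ _).trans (add_le_add (hK.2 m x) (hL.2 m x))

theorem cbBounds_smul {n : ℕ} (c : ℂ) {f : Matrix (Fin n) (Fin n) (StrongDual ℂ F)} {K : ℝ}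
    (hK : K ∈ cbBounds f) : ‖c‖ * K ∈ cbBounds (c • f) := by
  refine ⟨mul_nonneg (norm_nonneg _) hK.1, fun m x => ?_⟩
  rw [pairing_smul, norm_smul, mul_assoc]
  exact mul_le_mul_of_nonneg_left (hK.2 m x) (norm_nonneg _)

theorem zero_mem_cbBounds (n : ℕ) :
    (0 : ℝ) ∈ cbBounds (0 : Matrix (Fin n) (Fin n) (StrongDual ℂ F)) := by
  refine ⟨le_rfl, fun m x => ?_⟩
  have : pairing (0 : Matrix (Fin n) (Fin n) (StrongDual ℂ F)) x = 0 := by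
    ext; simp [pairing]
  simp [this]

theorem cbBounds_nonempty {n : ℕ} (f : Matrix (Fin n) (Fin n) (StrongDual ℂ F)) :
    (cbBounds f).Nonempty := by
  have hsum : ∀ (ι : Type) (s : Finset ι) (g : ι → Matrix (Fin n) (Fin n) (StrongDual ℂ F)),
      (∀ i, (cbBounds (g i)).Nonempty) → (cbBounds (∑ i ∈ s, g i)).Nonempty := by
    intro ι s g hg
    classical
    induction s using Finset.induction_on with
    | empty => exact ⟨0, by simpa using zero_mem_cbBounds n⟩
    | insert i s hi ih =>
      rw [Finset.sum_insert hi]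
      obtain ⟨K, hK⟩ := hg i
      obtain ⟨L, hL⟩ := ih
      exact ⟨_, cbBounds_add hK hL⟩
  have hf : f = ∑ i, ∑ j, sandwich (Matrix.of fun a _ => if a = i then 1 else 0)
      (Matrix.of fun (_ _ : Fin 1) => f i j) (Matrix.of fun _ b => if b = j then 1 else 0) := by
    refine Matrix.ext fun a b => ?_
    have h1 : ∀ i j, sandwich (Matrix.of fun a _ => if a = i then 1 else 0)
        (Matrix.of fun (_ _ : Fin 1) => f i j) (Matrix.of fun _ b => if b = j then 1 else 0) a b =
        if a = i then (if b = j then f i j else 0) else 0 := by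
      intro i j
      by_cases ha : a = i <;> by_cases hb : b = j <;> simp only [sandwich, ha, hb, Matrix.of_apply,
        Finset.univ_unique, Finset.sum_singleton, if_true, if_false, mul_one, mul_zero, one_smul]
      all_goals exact zero_smul ℂ (f i j)
    simp only [Matrix.sum_apply, h1, Finset.sum_ite_eq, Finset.sum_ite_irrel,
      Finset.sum_const_zero, Finset.mem_univ, if_true]
  rw [hf]
  refine hsum _ _ _ fun i => hsum _ _ _ fun j => ⟨_, cbBounds_sandwich _ _ (K := ‖f i j‖) ?_⟩
  exact ⟨norm_nonneg _, fun m x => pairing_one _ _⟩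

theorem dualNorm_mem {n : ℕ} (f : Matrix (Fin n) (Fin n) (StrongDual ℂ F)) :
    dualNorm f ∈ cbBounds f := by
  refine ⟨le_csInf (cbBounds_nonempty f) fun _ h => h.1, fun m x => ?_⟩
  have hN : 0 ≤ matNorm m x := apply_nonneg _ _
  rcases eq_or_lt_of_le hN with h0 | h0
  · obtain ⟨K, hK⟩ := cbBounds_nonempty f
    have := hK.2 m x
    rw [← h0, mul_zero] at this ⊢
    exact this
  · rw [← div_le_iff₀ h0]
    exact le_csInf (cbBounds_nonempty f) fun K hK => (div_le_iff₀ h0).2 (hK.2 m x)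

theorem dualNorm_le {n : ℕ} {f : Matrix (Fin n) (Fin n) (StrongDual ℂ F)} {K : ℝ}
    (h : K ∈ cbBounds f) : dualNorm f ≤ K := csInf_le (cbBounds_bddBelow f) h

theorem dualNorm_zero (n : ℕ) :
    dualNorm (0 : Matrix (Fin n) (Fin n) (StrongDual ℂ F)) = 0 :=
  le_antisymm (dualNorm_le (zero_mem_cbBounds n)) (dualNorm_mem _).1

theorem dualNorm_add_le {n : ℕ} (f g : Matrix (Fin n) (Fin n) (StrongDual ℂ F)) :
    dualNorm (f + g) ≤ dualNorm f + dualNorm g :=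
  dualNorm_le (cbBounds_add (dualNorm_mem f) (dualNorm_mem g))

theorem dualNorm_smul {n : ℕ} (c : ℂ) (f : Matrix (Fin n) (Fin n) (StrongDual ℂ F)) :
    dualNorm (c • f) = ‖c‖ * dualNorm f := by
  rcases eq_or_ne c 0 with rfl | hc
  · have h0 : (0 : ℂ) • f = 0 := zero_smul ℂ f
    rw [h0, dualNorm_zero, norm_zero, zero_mul]
  · refine le_antisymm (dualNorm_le (cbBounds_smul c (dualNorm_mem f))) ?_
    have h := dualNorm_le (cbBounds_smul c⁻¹ (dualNorm_mem (c • f)))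
    rw [inv_smul_smul₀ hc, norm_inv, ← div_eq_inv_mul, le_div_iff₀ (norm_pos_iff.2 hc)] at h
    rwa [mul_comm]

theorem dualNorm_neg {n : ℕ} (f : Matrix (Fin n) (Fin n) (StrongDual ℂ F)) :
    dualNorm (-f) = dualNorm f := by
  rw [← neg_one_smul ℂ f, dualNorm_smul, norm_neg, norm_one, one_mul]

theorem dualNorm_one (φ : StrongDual ℂ F) :
    dualNorm (n := 1) (Matrix.of fun _ _ => φ) = ‖φ‖ := by
  refine le_antisymm (dualNorm_le ⟨norm_nonneg _, fun m x => pairing_one _ _⟩) ?_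
  have hm := dualNorm_mem (n := 1) (Matrix.of fun _ _ => φ)
  refine ContinuousLinearMap.opNorm_le_bound _ hm.1 fun v => ?_
  have h := hm.2 1 (Matrix.of fun _ _ => v)
  rw [matNorm_one] at h
  refine le_trans ?_ h
  have h2 := sq_le_norm (pairing (n := 1) (Matrix.of fun _ _ => φ)
    (Matrix.of fun (_ _ : Fin 1) => v)) fun _ => 1
  simp only [pairing, mulVec, dotProduct, Fintype.sum_prod_type, Fin.sum_univ_one,
    Matrix.of_apply, mul_one, norm_one, one_pow] at h2
  exact (sq_le_sq₀ (norm_nonneg _) (norm_nonneg _)).1 h2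

theorem norm_select_row {a b : ℕ} (σ : Fin a → Fin b) (hσ : Function.Injective σ) :
    ‖(Matrix.of fun i k => if k = σ i then 1 else 0 : Matrix (Fin a) (Fin b) ℂ)‖ ≤ 1 := by
  refine norm_le_of_sq _ zero_le_one fun v => ?_
  simp only [mulVec, dotProduct, Matrix.of_apply, ite_mul, one_mul, zero_mul, Finset.sum_ite_eq',
    Finset.mem_univ, if_true, one_pow]
  rw [← Finset.sum_image (f := fun j => ‖v j‖ ^ 2) (s := Finset.univ) (g := σ)
    (fun _ _ _ _ h => hσ h)]
  exact Finset.sum_le_sum_of_subset_of_nonneg (Finset.subset_univ _)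
    fun _ _ _ => by positivity

theorem norm_select_col {a b : ℕ} (σ : Fin a → Fin b) (hσ : Function.Injective σ) :
    ‖(Matrix.of fun l j => if l = σ j then 1 else 0 : Matrix (Fin b) (Fin a) ℂ)‖ ≤ 1 := by
  have : (Matrix.of fun l j => if l = σ j then 1 else 0 : Matrix (Fin b) (Fin a) ℂ) =
      (Matrix.of fun i k => if k = σ i then 1 else 0 : Matrix (Fin a) (Fin b) ℂ)ᴴ := by
    ext l j
    by_cases h : l = σ j <;> simp [h]
  rw [this, Matrix.l2_opNorm_conjTranspose]
  exact norm_select_row σ hσ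

theorem dualNorm_sandwich {m n : ℕ} (α : Matrix (Fin n) (Fin m) ℂ)
    (f : Matrix (Fin m) (Fin m) (StrongDual ℂ F)) (β : Matrix (Fin m) (Fin n) ℂ) :
    dualNorm (sandwich α f β) ≤ ‖α‖ * dualNorm f * ‖β‖ :=
  dualNorm_le (cbBounds_sandwich α β (dualNorm_mem f))

theorem dualNorm_select_le {a b : ℕ} (σ : Fin a → Fin b) (hσ : Function.Injective σ)
    (f : Matrix (Fin b) (Fin b) (StrongDual ℂ F)) :
    dualNorm (sandwich (Matrix.of fun i k => if k = σ i then 1 else 0) f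
      (Matrix.of fun l j => if l = σ j then 1 else 0)) ≤ dualNorm f := by
  refine (dualNorm_sandwich _ _ _).trans ?_
  have h0 := (dualNorm_mem f).1
  calc _ ≤ 1 * dualNorm f * 1 := by
        gcongr
        · exact norm_select_row σ hσ
        · exact norm_select_col σ hσ
    _ = _ := by ring

theorem dualNorm_directSum {a b : ℕ} (f : Matrix (Fin a) (Fin a) (StrongDual ℂ F))
    (g : Matrix (Fin b) (Fin b) (StrongDual ℂ F)) :
    dualNorm (directSum f g) = max (dualNorm f) (dualNorm g) := by
  refine le_antisymm (dualNorm_le ⟨le_max_of_le_left (dualNorm_mem f).1, fun m x => ?_⟩)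
    (max_le ?_ ?_)
  · have hN : 0 ≤ matNorm m x := apply_nonneg _ _
    exact pairing_directSum_sq f g x
      (((dualNorm_mem f).2 m x).trans (mul_le_mul_of_nonneg_right (le_max_left _ _) hN))
      (((dualNorm_mem g).2 m x).trans (mul_le_mul_of_nonneg_right (le_max_right _ _) hN))
  · conv_lhs => rw [← sandwich_left f g]
    exact dualNorm_select_le _ (Fin.castAdd_injective a b) _
  · conv_lhs => rw [← sandwich_right f g]
    exact dualNorm_select_le _ (Fin.natAdd_injective b a) _

end facts

/-- The norm of `M_n(F*)` as a seminorm. -/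
def dualSeminorm (F : Type*) [NormedAddCommGroup F] [NormedSpace ℂ F] [OperatorSpace F] (n : ℕ) :
    Seminorm ℂ (Matrix (Fin n) (Fin n) (StrongDual ℂ F)) where
  toFun := dualNorm
  map_zero' := dualNorm_zero n
  add_le' := dualNorm_add_le
  neg' := dualNorm_neg
  smul' := dualNorm_smul

/-- The (standard) dual operator space `F*`, with `M_n(F*) = CB(F, M_n)` isometrically. -/
instance instOperatorSpaceDual {F : Type*} [NormedAddCommGroup F] [NormedSpace ℂ F]
    [OperatorSpace F] : OperatorSpace (StrongDual ℂ F) where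
  matNorm := dualSeminorm F
  matNorm_one := dualNorm_one
  matNorm_directSum := dualNorm_directSum
  matNorm_sandwich := dualNorm_sandwich

/-! ## Homogeneous and Hilbertian operator spaces -/

/-- `T` is completely bounded with `‖T‖_cb ≤ K`: all amplifications
`M_n(E) → M_n(F)`, `(x_{ij}) ↦ (T x_{ij})`, have norm at most `K`. -/
def CBNormLE {E F : Type*} [NormedAddCommGroup E] [NormedSpace ℂ E] [OperatorSpace E]
    [NormedAddCommGroup F] [NormedSpace ℂ F] [OperatorSpace F] (T : E →L[ℂ] F) (K : ℝ) : Prop :=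
  ∀ (n : ℕ) (x : Matrix (Fin n) (Fin n) E), matNorm n (x.map T) ≤ K * matNorm n x

/-- `F` is `lam`-homogeneous: every bounded `T : F → F` is completely bounded with
`‖T‖_cb ≤ lam ‖T‖`. -/
def IsHomogeneousWith (F : Type*) [NormedAddCommGroup F] [NormedSpace ℂ F] [OperatorSpace F]
    (lam : ℝ) : Prop :=
  ∀ T : F →L[ℂ] F, CBNormLE T (lam * ‖T‖)

/-- `F` is homogeneous. -/
def IsHomogeneous (F : Type*) [NormedAddCommGroup F] [NormedSpace ℂ F] [OperatorSpace F] : Prop :=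
  ∃ lam : ℝ, IsHomogeneousWith F lam

/-- `F` is `lam`-Hilbertian: there is an isomorphism `T` of a Hilbert space onto `F` such that
`‖T‖ ‖T⁻¹‖ ≤ lam`. -/
def IsHilbertianWith (F : Type u) [NormedAddCommGroup F] [NormedSpace ℂ F] (lam : ℝ) : Prop :=
  ∃ (H : Type u) (_ : NormedAddCommGroup H) (_ : InnerProductSpace ℂ H) (_ : CompleteSpace H)
    (T : H ≃L[ℂ] F), ‖(T : H →L[ℂ] F)‖ * ‖(T.symm : F →L[ℂ] H)‖ ≤ lam

/-- `F` is Hilbertian. -/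
def IsHilbertian (F : Type u) [NormedAddCommGroup F] [NormedSpace ℂ F] : Prop :=
  ∃ lam : ℝ, IsHilbertianWith F lam

/-- `e_0, e_1, …` (only the terms `e_k` with `k < dim F` matter) is the image under `T` of an
orthonormal system in the Hilbert space `H`; it has infinitely many terms if `dim F = ∞`, and
`dim F` terms otherwise. Every orthonormal system is part of an orthonormal basis. -/
def IsOrthonormalImage {H F : Type*} [NormedAddCommGroup H] [InnerProductSpace ℂ H]
    [NormedAddCommGroup F] [NormedSpace ℂ F] (T : H ≃L[ℂ] F) (e : ℕ → F) : Prop :=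
  Orthonormal ℂ fun k : {k : ℕ // (k : Cardinal) < Module.rank ℂ F} => T.symm (e k)

/-- `e` is an orthonormal system of the space `F` that is isometric to a Hilbert space: the image
of one under a surjective isometry. -/
def IsOrthonormalIn (F : Type u) [NormedAddCommGroup F] [NormedSpace ℂ F] (e : ℕ → F) : Prop :=
  ∃ (H : Type u) (_ : NormedAddCommGroup H) (_ : InnerProductSpace ℂ H) (_ : CompleteSpace H)
    (T : H ≃ₗᵢ[ℂ] F), IsOrthonormalImage T.toContinuousLinearEquiv e

/-! ## Fundamental functions -/

/-- The tensor `a ⊗ v ∈ M_n ⊗ F = M_n(F)`. -/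
def tensor {F : Type*} [NormedAddCommGroup F] [NormedSpace ℂ F] {n : ℕ}
    (a : Matrix (Fin n) (Fin n) ℂ) (v : F) : Matrix (Fin n) (Fin n) F :=
  a.map fun z => z • v

/-- The matrix unit `e_{k1} ∈ M_n` (the first column has index `0`). -/
def colUnit {n : ℕ} (k : Fin n) : Matrix (Fin n) (Fin n) ℂ :=
  Matrix.single k ⟨0, k.pos⟩ 1

/-- The matrix unit `e_{1k} ∈ M_n` (the first row has index `0`). -/
def rowUnit {n : ℕ} (k : Fin n) : Matrix (Fin n) (Fin n) ℂ :=
  Matrix.single ⟨0, k.pos⟩ k 1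

/-- `Φ_c(n) = ‖∑_{k ≤ n} e_{k1} ⊗ e_k‖²` in `C ⊗_min F`. The tensor lies in
`C^n ⊗_min F ⊆ M_n ⊗_min F = M_n(F)`. -/
def fundCol {F : Type*} [NormedAddCommGroup F] [NormedSpace ℂ F] [OperatorSpace F]
    (e : ℕ → F) (n : ℕ) : ℝ :=
  matNorm n (∑ k : Fin n, tensor (colUnit k) (e k)) ^ 2

/-- `Φ_r(n) = ‖∑_{k ≤ n} e_{1k} ⊗ e_k‖²` in `R ⊗_min F`. The tensor lies in
`R^n ⊗_min F ⊆ M_n ⊗_min F = M_n(F)`. -/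
def fundRow {F : Type*} [NormedAddCommGroup F] [NormedSpace ℂ F] [OperatorSpace F]
    (e : ℕ → F) (n : ℕ) : ℝ :=
  matNorm n (∑ k : Fin n, tensor (rowUnit k) (e k)) ^ 2

/-- Regularity of `F`: for a system `e` in `F` that is the image of an orthonormal system under an
isomorphism of a Hilbert space onto `F`, both fundamental functions grow between two powers with
exponents in `(0, 1)`. -/
def IsRegular (F : Type u) [NormedAddCommGroup F] [NormedSpace ℂ F] [OperatorSpace F] : Prop :=
  ∃ (H : Type u) (_ : NormedAddCommGroup H) (_ : InnerProductSpace ℂ H) (_ : CompleteSpace H)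
    (T : H ≃L[ℂ] F) (e : ℕ → F), IsOrthonormalImage T e ∧
    ∃ c d α β : ℝ, 0 < c ∧ 0 < d ∧ 0 < α ∧ α ≤ β ∧ β < 1 ∧
      ∀ k n : ℕ, 1 ≤ k → k ≤ n → (n : Cardinal) ≤ Module.rank ℂ F →
        (c * ((n : ℝ) / k) ^ α ≤ fundCol e n / fundCol e k ∧
          fundCol e n / fundCol e k ≤ d * ((n : ℝ) / k) ^ β) ∧
        (c * ((n : ℝ) / k) ^ α ≤ fundRow e n / fundRow e k ∧
          fundRow e n / fundRow e k ≤ d * ((n : ℝ) / k) ^ β)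

end OpSpace

end

noncomputable section

namespace OpSpace

open OperatorSpace Matrix

/-! Take an orthonormal system `e` with coordinate functionals `f`, and let A, B be the norms of the
columns ∑ e_{k1} ⊗ e_k and ∑ e_{k1} ⊗ f_k. Pairing the two columns sends a unit vector to ∑ δ_k ⊗
δ_k, of norm √n, so √n ≤ AB (`le_fundCol_mul_fundCol`).

The converse AB ≤ L√n, with L = lam ‖T‖ ‖T⁻¹‖, is an averaging argument (`sqrt_sum_mul_matNorm_le`).
As a cb-norm, B is the least constant bounding the Hilbert–Schmidt norm √s of the scalar matrix a =
(f_k((xξ)_i)) by ‖x‖ ‖ξ‖. By homogeneity the n² operators e_k ↦ ζ^{q(k+p)} e_{k+p}, with p, q in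
ℤ/n, can be applied to the entries of x at the uniform cost L, and by Ruan's axiom their results fit
into one block diagonal matrix of norm at most L‖x‖. Stacking the corresponding translates and
modulations of a gives W with W*W = ns·1, so compressing by W* and by n² copies of ξ returns ns
times the column of `e`. Hence nsA ≤ √(ns) · L‖x‖ · n‖ξ‖, that is, √s A ≤ L√n ‖x‖ ‖ξ‖. For lam = 1
and T isometric, L ≤ 1 and the product is exactly n.

Rows are columns of the opposite operator space, and dualizing commutes with taking opposites. For
unrelated systems in (i), Riesz representation makes the given system of F* dual to some orthonormal
system of F (`exists_predual_orthonormal`), and homogeneity makes fundamental functions independent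
of the system (`fundCol_le_fundCol`). For (ii), a product comparable with n turns the exponents α, β
into 1 - β, 1 - α (`power_growth_of_mul`); returning from F* to F uses reflexivity
(`exists_predual_equiv`). -/

/-! ### Norms of scalar matrices -/

theorem norm_reindex_le {ι κ ι' κ' : Type*} [Fintype ι] [Fintype κ] [Fintype ι'] [Fintype κ']
    [DecidableEq κ] [DecidableEq κ'] (A : Matrix ι κ ℂ) (s : ι' ≃ ι) (t : κ' ≃ κ) :
    ‖A.submatrix s t‖ ≤ ‖A‖ := by
  refine norm_le_of_sq _ (norm_nonneg _) fun v => ?_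
  have h := sq_le_norm A (v ∘ t.symm)
  rw [Matrix.submatrix_mulVec_equiv]
  rw [← Equiv.sum_comp s fun i => ‖(A *ᵥ (v ∘ t.symm)) i‖ ^ 2,
    ← Equiv.sum_comp t fun j => ‖(v ∘ t.symm) j‖ ^ 2] at h
  simpa using h

theorem norm_transpose_le {ι κ : Type*} [Fintype ι] [Fintype κ] [DecidableEq ι] [DecidableEq κ]
    (A : Matrix ι κ ℂ) :
    ‖Aᵀ‖ ≤ ‖A‖ := by
  -- The adjoint of Aᵀ is the entrywise conjugate of A, which acts as A up to conjugating input and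
  -- output.
  rw [← Matrix.l2_opNorm_conjTranspose Aᵀ]
  refine norm_le_of_sq _ (norm_nonneg _) fun v => ?_
  have h := sq_le_norm A (star v)
  have e : ∀ i, (Aᵀᴴ *ᵥ v) i = star ((A *ᵥ star v) i) := by
    intro i
    simp [mulVec, dotProduct]
  simpa [e] using h

theorem norm_transpose {ι κ : Type*} [Fintype ι] [Fintype κ] [DecidableEq ι] [DecidableEq κ]
    (A : Matrix ι κ ℂ) :
    ‖Aᵀ‖ = ‖A‖ :=
  le_antisymm (norm_transpose_le A) (by simpa using norm_transpose_le Aᵀ)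

theorem norm_le_sqrt_of_conjTranspose_mul_self {ι κ : Type*} [Fintype ι] [Fintype κ]
    [DecidableEq ι] [DecidableEq κ] {W : Matrix ι κ ℂ} {c : ℝ} (hc : 0 ≤ c)
    (h : Wᴴ * W = (c : ℂ) • (1 : Matrix κ κ ℂ)) : ‖W‖ ≤ √c := by
  refine Real.le_sqrt_of_sq_le ?_
  rw [sq, ← Matrix.l2_opNorm_conjTranspose_mul_self, h]
  refine norm_le_of_sq _ hc fun v => ?_
  simp [Matrix.smul_mulVec, mul_pow, Finset.mul_sum, abs_of_nonneg hc]

/-! ### Columns, block diagonals and the lower bound for the product -/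

section

variable {F : Type*} [NormedAddCommGroup F] [NormedSpace ℂ F]

theorem sum_tensor_colUnit_apply (e : ℕ → F) {n : ℕ} (i j : Fin n) :
    (∑ k : Fin n, tensor (colUnit k) (e k)) i j = if (j : ℕ) = 0 then e i else 0 := by
  rw [Matrix.sum_apply, Finset.sum_eq_single i]
  · by_cases h : (j : ℕ) = 0
    · have : (⟨0, i.pos⟩ : Fin n) = j := Fin.ext h.symm
      simp [tensor, colUnit, this, h]
    · have : (⟨0, i.pos⟩ : Fin n) ≠ j := fun h' => h (by rw [← h'])
      simp [tensor, colUnit, this, h]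
  · intro k _ hk
    simp [tensor, colUnit, hk]
  · simp

theorem sum_tensor_rowUnit (e : ℕ → F) (n : ℕ) :
    ∑ k : Fin n, tensor (rowUnit k) (e k) = (∑ k : Fin n, tensor (colUnit k) (e k))ᵀ := by
  rw [Matrix.transpose_sum]
  refine Finset.sum_congr rfl fun k _ => ?_
  rw [tensor, tensor, ← Matrix.transpose_map, colUnit, rowUnit, Matrix.transpose_single]

/-- Only the block of `v` at the first column index survives, so cb-norms of columns reduce to
estimates on vectors xξ with ξ a single block. -/
theorem pairing_col_apply (f : ℕ → StrongDual ℂ F) {n m : ℕ} (x : Matrix (Fin m) (Fin m) F)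
    (v : Fin n × Fin m → ℂ) (k : Fin n) (i : Fin m) :
    (pairing (∑ k : Fin n, tensor (colUnit k) (f k)) x *ᵥ v) (k, i) =
      f k (∑ j, v (⟨0, k.pos⟩, j) • x i j) := by
  simp only [pairing, mulVec, dotProduct, Matrix.of_apply, Fintype.sum_prod_type, map_sum,
    map_smul, smul_eq_mul, sum_tensor_colUnit_apply]
  rw [Finset.sum_eq_single ⟨0, k.pos⟩]
  · simp [mul_comm]
  · intro b _ hb
    have : (b : ℕ) ≠ 0 := fun h => hb (Fin.ext h)
    simp [this]
  · simp

variable [OperatorSpace F]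

/-- A block diagonal matrix indexed by a finite type has norm at most the supremum of the norms of
its blocks. -/
theorem exists_blockDiagonal (ι : Type) [Fintype ι] [DecidableEq ι] {m : ℕ} {K : ℝ} (hK : 0 ≤ K)
    (X : ι → Matrix (Fin m) (Fin m) F) (hX : ∀ g, matNorm m (X g) ≤ K) :
    ∃ (M : ℕ) (Z : Matrix (Fin M) (Fin M) F) (ε : ι × Fin m ≃ Fin M), matNorm M Z ≤ K ∧
      ∀ g i h j, Z (ε (g, i)) (ε (h, j)) = if g = h then X g i j else 0 := by
  -- Induction on the number of blocks. Keeping the size M and the indexing ε existential avoids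
  -- casts between `Fin` types of equal cardinality.
  suffices H : ∀ N : ℕ, ∀ X : Fin N → Matrix (Fin m) (Fin m) F, (∀ g, matNorm m (X g) ≤ K) →
      ∃ (M : ℕ) (Z : Matrix (Fin M) (Fin M) F) (ε : Fin N × Fin m ≃ Fin M), matNorm M Z ≤ K ∧
      ∀ g i h j, Z (ε (g, i)) (ε (h, j)) = if g = h then X g i j else 0 by
    obtain ⟨M, Z, ε, h1, h2⟩ := H _ (X ∘ (Fintype.equivFin ι).symm) fun g => hX _
    refine ⟨M, Z, ((Fintype.equivFin ι).prodCongr (Equiv.refl _)).trans ε, h1, fun g i h j => ?_⟩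
    simp [h2]
  intro N
  induction N with
  | zero =>
    intro X _
    refine ⟨0, 0, Equiv.equivOfIsEmpty _ _, by simpa using hK, fun g => g.elim0⟩
  | succ N ih =>
    intro X hX
    obtain ⟨M, Z, ε, h1, h2⟩ := ih (fun g => X g.castSucc) fun g => hX _
    -- Splits off the last block, to match the shape of `directSum`.
    let s : Fin (N + 1) × Fin m ≃ (Fin N × Fin m) ⊕ Fin m :=
      ((finSumFinEquiv (m := N) (n := 1)).symm.prodCongr (Equiv.refl (Fin m))).trans
        ((Equiv.sumProdDistrib _ _ _).trans
          ((Equiv.refl _).sumCongr (Equiv.uniqueProd (Fin m) (Fin 1))))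
    have s1 : ∀ (g : Fin N) i, s (g.castSucc, i) = Sum.inl (g, i) := by
      intro g i
      have : (finSumFinEquiv (m := N) (n := 1)).symm g.castSucc = Sum.inl g :=
        finSumFinEquiv_symm_apply_castAdd g
      simp [s, this]
    have s2 : ∀ i, s (Fin.last N, i) = Sum.inr i := by
      intro i
      have : (finSumFinEquiv (m := N) (n := 1)).symm (Fin.last N) = Sum.inr 0 :=
        finSumFinEquiv_symm_apply_natAdd 0
      simp [s, this]
    refine ⟨M + m, directSum Z (X (Fin.last N)),
      (s.trans (ε.sumCongr (Equiv.refl _))).trans finSumFinEquiv, ?_, ?_⟩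
    · rw [matNorm_directSum]
      exact max_le h1 (hX _)
    · intro g i h j
      refine Fin.lastCases ?_ (fun g => ?_) g <;> refine Fin.lastCases ?_ (fun h => ?_) h
      · simp [s2, directSum]
      · simp [s1, s2, directSum, (Fin.castSucc_lt_last h).ne']
      · simp [s1, s2, directSum, (Fin.castSucc_lt_last g).ne]
      · simp [s1, directSum, h2]

/-- By biorthogonality the paired columns form a scalar matrix with one nonzero column, the
indicator of the diagonal of `Fin n × Fin n`. Its norm √n is at most the product of the two column
norms, by definition of the dual norm. -/
theorem le_fundCol_mul_fundCol (e : ℕ → F) (f : ℕ → StrongDual ℂ F) (n : ℕ)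
    (h : ∀ i j : Fin n, f i (e j) = if i = j then 1 else 0) :
    (n : ℝ) ≤ fundCol e n * fundCol f n := by
  rcases Nat.eq_zero_or_pos n with rfl | hn
  · simp only [Nat.cast_zero, fundCol]; positivity
  set x := ∑ k : Fin n, tensor (colUnit k) (e k) with hx
  set y := ∑ k : Fin n, tensor (colUnit k) (f k) with hy
  have h1 : ‖pairing y x‖ ≤ matNorm n y * matNorm n x := (dualNorm_mem y).2 n x
  have h2 := sq_le_norm (pairing y x)
    (fun p => if p = (⟨0, hn⟩, ⟨0, hn⟩) then 1 else 0)
  have h3 : ∀ p : Fin n × Fin n, (pairing y x *ᵥ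
      (fun p => if p = (⟨0, hn⟩, ⟨0, hn⟩) then 1 else 0)) p = if p.1 = p.2 then 1 else 0 := by
    rintro ⟨k, i⟩
    rw [hy, pairing_col_apply, Finset.sum_eq_single ⟨0, hn⟩]
    · simp [hx, sum_tensor_colUnit_apply, h]
    · intro b _ hb
      simp [hb]
    · simp
  simp only [h3, Fintype.sum_prod_type] at h2
  simp only [apply_ite norm, norm_one, norm_zero, ite_pow, one_pow, ne_eq, OfNat.ofNat_ne_zero,
    not_false_eq_true, zero_pow, Prod.mk.injEq, ite_and, Finset.sum_ite_eq, Finset.sum_ite_eq',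
    Finset.mem_univ, if_true, Finset.sum_const, Finset.card_univ, Fintype.card_fin,
    nsmul_eq_mul, mul_one, Finset.sum_ite_irrel, mul_zero] at h2
  calc (n : ℝ) ≤ ‖pairing y x‖ ^ 2 := h2
    _ ≤ (matNorm n y * matNorm n x) ^ 2 := by gcongr
    _ = _ := by rw [fundCol, fundCol, mul_pow, mul_comm]

end

/-! ### Finite-rank operators between orthonormal systems -/

section orthonormal

variable {H : Type*} [NormedAddCommGroup H] [InnerProductSpace ℂ H]

/-- The operator `∑ a_k^* ⊗ b_k`. -/
def rankSum {n : ℕ} (a b : Fin n → H) : H →L[ℂ] H :=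
  ∑ k, (innerSL ℂ (a k)).smulRight (b k)

theorem rankSum_apply {n : ℕ} (a b : Fin n → H) (x : H) :
    rankSum a b x = ∑ k, inner ℂ (a k) x • b k := by
  simp [rankSum]

theorem norm_rankSum_le {n : ℕ} {a b : Fin n → H} (ha : Orthonormal ℂ a) (hb : Orthonormal ℂ b) :
    ‖rankSum a b‖ ≤ 1 := by
  refine ContinuousLinearMap.opNorm_le_bound _ zero_le_one fun x => ?_
  rw [one_mul, rankSum_apply]
  refine (sq_le_sq₀ (norm_nonneg _) (norm_nonneg _)).1 ?_
  -- Bessel's inequality for `a`; orthonormality of `b` makes its left side equal to the squared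
  -- norm of the image of x.
  have h := ha.sum_inner_products_le x (s := Finset.univ)
  refine le_trans (le_of_eq ?_) h
  rw [@norm_sq_eq_re_inner ℂ, hb.inner_sum]
  simp only [RCLike.conj_mul, map_sum]
  norm_cast

/-- Provides the target systems of the operators that translate and modulate an orthonormal system.
-/
theorem orthonormal_phase {n : ℕ} {b : Fin n → H} (hb : Orthonormal ℂ b) (σ : Fin n ≃ Fin n)
    {θ : Fin n → ℂ} (hθ : ∀ k, ‖θ k‖ = 1) : Orthonormal ℂ fun k => θ (σ k) • b (σ k) := by
  rw [orthonormal_iff_ite] at hb ⊢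
  intro i j
  rw [inner_smul_left, inner_smul_right, hb]
  by_cases h : i = j
  · subst h
    simp [Complex.conj_mul', hθ]
  · simp [h]

end orthonormal

/-- Orthogonality of the characters of the cyclic group of order `n`. -/
theorem sum_conj_pow_mul_pow {n : ℕ} {ζ : ℂ} (hζ : IsPrimitiveRoot ζ n) (k l : Fin n) :
    ∑ q : Fin n, star (ζ ^ ((q : ℕ) * k)) * ζ ^ ((q : ℕ) * l) = if k = l then (n : ℂ) else 0 := by
  have hn : n ≠ 0 := fun h => by subst h; exact k.elim0
  have hz : ‖ζ‖ = 1 := Complex.norm_eq_one_of_pow_eq_one hζ.pow_eq_one hn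
  have hs : star ζ = ζ⁻¹ := (Complex.inv_eq_conj hz).symm
  have hz0 : ζ ≠ 0 := hζ.ne_zero hn
  have e : ∀ q : Fin n, star (ζ ^ ((q : ℕ) * k)) * ζ ^ ((q : ℕ) * l) =
      ((ζ ^ (k : ℕ))⁻¹ * ζ ^ (l : ℕ)) ^ (q : ℕ) := by
    intro q
    rw [star_pow, hs, mul_pow, ← pow_mul, inv_pow, inv_pow, ← pow_mul, mul_comm (k : ℕ),
      mul_comm (l : ℕ)]
  simp only [e]
  rw [Fin.sum_univ_eq_sum_range fun q => ((ζ ^ (k : ℕ))⁻¹ * ζ ^ (l : ℕ)) ^ q]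
  split_ifs with h
  · subst h
    simp [inv_mul_cancel₀ (pow_ne_zero _ hz0)]
  · rw [geom_sum_eq, mul_pow, inv_pow, ← pow_mul, ← pow_mul, mul_comm (k : ℕ), mul_comm (l : ℕ),
      pow_mul, pow_mul, hζ.pow_eq_one]
    · simp
    · intro h1
      rw [inv_mul_eq_one₀ (pow_ne_zero _ hz0)] at h1
      exact h (Fin.ext (hζ.pow_inj k.2 l.2 h1))

/-! ### The averaging argument and the upper bound for the product -/

section transport

variable {F : Type*} [NormedAddCommGroup F] [NormedSpace ℂ F]
  {H : Type*} [NormedAddCommGroup H] [InnerProductSpace ℂ H]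

/-- The operator `∑ a_k^* ⊗ b_k`, transported to `F` along an isomorphism `T`. -/
def transportRankSum (T : H ≃L[ℂ] F) {n : ℕ} (a b : Fin n → H) : F →L[ℂ] F :=
  (T : H →L[ℂ] F) ∘L rankSum a b ∘L (T.symm : F →L[ℂ] H)

theorem transportRankSum_apply (T : H ≃L[ℂ] F) {n : ℕ} (a b : Fin n → H) (v : F) :
    transportRankSum T a b v = ∑ k, inner ℂ (a k) (T.symm v) • T (b k) := by
  simp [transportRankSum, rankSum_apply]

theorem norm_transportRankSum_le (T : H ≃L[ℂ] F) {n : ℕ} {a b : Fin n → H}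
    (ha : Orthonormal ℂ a) (hb : Orthonormal ℂ b) :
    ‖transportRankSum T a b‖ ≤ ‖(T : H →L[ℂ] F)‖ * ‖(T.symm : F →L[ℂ] H)‖ := by
  refine (ContinuousLinearMap.opNorm_comp_le _ _).trans ?_
  refine mul_le_mul_of_nonneg_left ?_ (norm_nonneg _)
  refine (ContinuousLinearMap.opNorm_comp_le _ _).trans ?_
  exact mul_le_of_le_one_left (norm_nonneg _) (norm_rankSum_le ha hb)

/-- If `a` is a matrix with columns indexed by the cyclic group, its images under all translations
and modulations of the columns, stacked upon each other, form a multiple of an isometry. -/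
theorem stacked_conjTranspose_mul_self {n m : ℕ} [NeZero n] {ζ : ℂ} (hζ : IsPrimitiveRoot ζ n)
    (a : Fin n → Fin m → ℂ) {W : Matrix ((Fin n × Fin n) × Fin m) (Fin n) ℂ}
    (hW : ∀ p q i l, W ((p, q), i) l = a (l - p) i * ζ ^ ((q : ℕ) * l)) :
    Wᴴ * W = ((n * ∑ k, ∑ i, ‖a k i‖ ^ 2 : ℝ) : ℂ) • (1 : Matrix (Fin n) (Fin n) ℂ) := by
  ext l l'
  simp only [Matrix.mul_apply, Fintype.sum_prod_type, Matrix.conjTranspose_apply, hW,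
    Matrix.smul_apply, Matrix.one_apply, smul_eq_mul]
  -- Summing over the modulations q kills the off-diagonal entries; on the diagonal, summing over
  -- the translations p runs through every column of `a` once.
  have h1 : ∀ p : Fin n, ∑ q : Fin n, ∑ i, star (a (l - p) i * ζ ^ ((q : ℕ) * l)) *
      (a (l' - p) i * ζ ^ ((q : ℕ) * l')) =
      (∑ i, star (a (l - p) i) * a (l' - p) i) * if l = l' then (n : ℂ) else 0 := by
    intro p
    rw [← sum_conj_pow_mul_pow hζ, Finset.sum_comm, Finset.sum_mul]
    refine Finset.sum_congr rfl fun i _ => ?_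
    rw [Finset.mul_sum]
    refine Finset.sum_congr rfl fun q _ => ?_
    rw [star_mul']
    ring
  simp only [h1]
  split_ifs with h
  · subst h
    have h2 := Equiv.sum_comp (Equiv.subLeft l) fun k => ∑ i, star (a k i) * a k i
    simp only [Equiv.subLeft_apply] at h2
    rw [← Finset.sum_mul, h2]
    push_cast
    rw [mul_one, mul_comm]
    simp [Complex.conj_mul']
  · simp

/-- The right factor repeats ξ in each block, so each diagonal block X_g acts on its own copy of ξ
and `Wᴴ` then combines all the vectors X_g ξ. -/
theorem sandwich_stacked {n m M : ℕ} {G : Type*} [Fintype G] [DecidableEq G]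
    (ε : G × Fin m ≃ Fin M)
    {Z : Matrix (Fin M) (Fin M) F} {X : G → Matrix (Fin m) (Fin m) F}
    (hZ : ∀ g i h j, Z (ε (g, i)) (ε (h, j)) = if g = h then X g i j else 0)
    (W : Matrix (G × Fin m) (Fin n) ℂ) (ξ : Fin m → ℂ) (l l' : Fin n) :
    sandwich (Wᴴ.submatrix id ε.symm) Z
      ((Matrix.of fun (p : G × Fin m) (k : Fin n) => if (k : ℕ) = 0 then ξ p.2 else 0).submatrix
        ε.symm id) l l' =
      if (l' : ℕ) = 0 then ∑ p : G × Fin m, star (W p l) • ∑ j, ξ j • X p.1 p.2 j else 0 := by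
  simp only [sandwich, Matrix.of_apply, Matrix.submatrix_apply, id,
    Matrix.conjTranspose_apply]
  rw [← Equiv.sum_comp ε]
  simp_rw [← Equiv.sum_comp ε (fun k => (_ * _) • Z _ k)]
  simp only [Equiv.symm_apply_apply]
  split_ifs with h0
  · refine Finset.sum_congr rfl fun p _ => ?_
    obtain ⟨g, i⟩ := p
    rw [Fintype.sum_prod_type, Finset.sum_eq_single g, Finset.smul_sum]
    · refine Finset.sum_congr rfl fun j _ => ?_
      rw [hZ, if_pos rfl, mul_smul]
    · intro h _ hh
      refine Finset.sum_eq_zero fun j _ => ?_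
      rw [hZ, if_neg hh.symm, smul_zero]
    · simp
  · simp

theorem norm_const_column_le {G : Type*} [Fintype G] [DecidableEq G] {m n : ℕ} (ξ : Fin m → ℂ) :
    ‖(Matrix.of fun (p : G × Fin m) (k : Fin n) => if (k : ℕ) = 0 then ξ p.2 else 0 :
      Matrix (G × Fin m) (Fin n) ℂ)‖ ≤ √(Fintype.card G * ∑ j, ‖ξ j‖ ^ 2) := by
  refine norm_le_of_sq _ (Real.sqrt_nonneg _) fun v => ?_
  rw [Real.sq_sqrt (by positivity)]
  rcases Nat.eq_zero_or_pos n with rfl | hn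
  · simp [mulVec, dotProduct]
  have e : ∀ p : G × Fin m, ((Matrix.of fun (p : G × Fin m) (k : Fin n) =>
      if (k : ℕ) = 0 then ξ p.2 else 0 : Matrix (G × Fin m) (Fin n) ℂ) *ᵥ v) p =
      ξ p.2 * v ⟨0, hn⟩ := by
    intro p
    rw [mulVec, dotProduct, Finset.sum_eq_single ⟨0, hn⟩]
    · simp
    · intro b _ hb
      have : (b : ℕ) ≠ 0 := fun h => hb (Fin.ext h)
      simp [this]
    · simp
  simp only [e, Fintype.sum_prod_type, norm_mul, mul_pow, ← Finset.sum_mul, Finset.sum_const,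
    Finset.card_univ, nsmul_eq_mul]
  gcongr
  exact Finset.single_le_sum (f := fun j => ‖v j‖ ^ 2) (fun _ _ => by positivity)
    (Finset.mem_univ _)

variable [OperatorSpace F]

theorem matNorm_map_transportRankSum_le (T : H ≃L[ℂ] F) {lam : ℝ} (hlam : 0 ≤ lam)
    (hF : IsHomogeneousWith F lam) {n : ℕ} {a b : Fin n → H} (ha : Orthonormal ℂ a)
    (hb : Orthonormal ℂ b) {m : ℕ} (x : Matrix (Fin m) (Fin m) F) :
    matNorm m (x.map (transportRankSum T a b)) ≤
      lam * (‖(T : H →L[ℂ] F)‖ * ‖(T.symm : F →L[ℂ] H)‖) * matNorm m x := by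
  refine (hF _ m x).trans ?_
  have hN : 0 ≤ matNorm m x := apply_nonneg _ _
  gcongr
  exact norm_transportRankSum_le T ha hb

/-- The fundamental functions of two orthonormal systems are comparable. -/
theorem fundCol_le_fundCol (T : H ≃L[ℂ] F) {lam : ℝ} (hlam : 0 ≤ lam)
    (hF : IsHomogeneousWith F lam) {e g : ℕ → F} {n : ℕ}
    (he : Orthonormal ℂ fun k : Fin n => T.symm (e k))
    (hg : Orthonormal ℂ fun k : Fin n => T.symm (g k)) :
    fundCol g n ≤
      (lam * (‖(T : H →L[ℂ] F)‖ * ‖(T.symm : F →L[ℂ] H)‖)) ^ 2 * fundCol e n := by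
  rw [fundCol, fundCol, ← mul_pow]
  have h := matNorm_map_transportRankSum_le T hlam hF he hg
    (∑ k : Fin n, tensor (colUnit k) (e k))
  have h2 : (∑ k : Fin n, tensor (colUnit k) (e k)).map (transportRankSum T
      (fun k : Fin n => T.symm (e k)) (fun k : Fin n => T.symm (g k))) =
      ∑ k : Fin n, tensor (colUnit k) (g k) := by
    ext i j
    rw [Matrix.map_apply, sum_tensor_colUnit_apply, sum_tensor_colUnit_apply]
    split_ifs
    · rw [transportRankSum_apply]
      simp [orthonormal_iff_ite.1 he, ite_smul]
    · simp
  rw [h2] at h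
  have h0 : 0 ≤ matNorm n (∑ k : Fin n, tensor (colUnit k) (g k)) := apply_nonneg _ _
  gcongr

/-- An element of the column space over `F` has Hilbert--Schmidt norm at most a multiple of its
norm; the best constant is governed by the fundamental function. -/
theorem sqrt_sum_mul_matNorm_le (T : H ≃L[ℂ] F) {lam : ℝ} (hlam : 0 ≤ lam)
    (hF : IsHomogeneousWith F lam) {e : ℕ → F} {f : ℕ → StrongDual ℂ F} {n : ℕ}
    (he : Orthonormal ℂ fun k : Fin n => T.symm (e k))
    (hf : ∀ (k : Fin n) v, f k v = inner ℂ (T.symm (e k)) (T.symm v)) {m : ℕ}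
    (x : Matrix (Fin m) (Fin m) F) (ξ : Fin m → ℂ) :
    √(∑ k : Fin n, ∑ i, ‖f k (∑ j, ξ j • x i j)‖ ^ 2) *
        matNorm n (∑ k : Fin n, tensor (colUnit k) (e k)) ≤
      √n * (lam * (‖(T : H →L[ℂ] F)‖ * ‖(T.symm : F →L[ℂ] H)‖) * matNorm m x) *
        √(∑ j, ‖ξ j‖ ^ 2) := by
  set N := lam * (‖(T : H →L[ℂ] F)‖ * ‖(T.symm : F →L[ℂ] H)‖) * matNorm m x with hN
  have hx0 : 0 ≤ matNorm m x := apply_nonneg _ _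
  have hN0 : 0 ≤ N := by positivity
  rcases Nat.eq_zero_or_pos n with rfl | hn
  · simp
  have : NeZero n := ⟨hn.ne'⟩
  set y : Fin m → F := fun i => ∑ j, ξ j • x i j with hy
  set a : Fin n → Fin m → ℂ := fun k i => f k (y i) with ha
  set s := ∑ k, ∑ i, ‖a k i‖ ^ 2 with hs
  have hs0 : 0 ≤ s := by positivity
  set ζ : ℂ := Complex.exp (2 * Real.pi * Complex.I / n) with hζd
  have hζ : IsPrimitiveRoot ζ n := Complex.isPrimitiveRoot_exp n hn.ne'
  have hz : ‖ζ‖ = 1 := Complex.norm_eq_one_of_pow_eq_one hζ.pow_eq_one hn.ne'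
  -- For g = (p, q), the k-th vector is ζ^{q(k+p)} times the (k+p)-th basis vector, with k + p taken
  -- modulo n.
  let b : Fin n × Fin n → Fin n → H := fun g k =>
    ζ ^ ((g.2 : ℕ) * (Equiv.addRight g.1 k : Fin n)) • T.symm (e (Equiv.addRight g.1 k : Fin n))
  have hb : ∀ g, Orthonormal ℂ (b g) := fun g =>
    orthonormal_phase he (Equiv.addRight g.1) (θ := fun k => ζ ^ ((g.2 : ℕ) * k))
      fun k => by rw [norm_pow, hz, one_pow]
  let S : Fin n × Fin n → F →L[ℂ] F := fun g =>
    transportRankSum T (fun k : Fin n => T.symm (e k)) (b g)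
  obtain ⟨M, Z, ε, hZN, hZ⟩ := exists_blockDiagonal (Fin n × Fin n) hN0 (fun g => x.map (S g))
    fun g => matNorm_map_transportRankSum_le T hlam hF he (hb g) x
  let W : Matrix ((Fin n × Fin n) × Fin m) (Fin n) ℂ := Matrix.of fun p l =>
    a (l - p.1.1) p.2 * ζ ^ ((p.1.2 : ℕ) * l)
  have hWW := stacked_conjTranspose_mul_self hζ a (W := W) fun _ _ _ _ => rfl
  rw [← hs] at hWW
  -- Expands S_g(xξ) in the system `e`: its coefficients form a row of `W`. Compressing by `Wᴴ` thus
  -- produces `Wᴴ * W` applied to the column of `e`.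
  have hS : ∀ p : (Fin n × Fin n) × Fin m,
      ∑ j, ξ j • (x.map (S p.1)) p.2 j = ∑ l : Fin n, W p l • e l := by
    rintro ⟨⟨p, q⟩, i⟩
    have h1 : ∑ j, ξ j • (x.map (S (p, q))) i j = S (p, q) (y i) := by
      simp [hy]
    rw [h1, transportRankSum_apply, ← Equiv.sum_comp (Equiv.addRight p) fun l => W _ l • e l]
    refine Finset.sum_congr rfl fun k _ => ?_
    rw [← hf]
    simp [b, W, ha, smul_smul]
  have hW := norm_le_sqrt_of_conjTranspose_mul_self (by positivity) hWW
  have key := matNorm_sandwich (Wᴴ.submatrix id ε.symm) Z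
    ((Matrix.of fun (p : (Fin n × Fin n) × Fin m) (k : Fin n) =>
      if (k : ℕ) = 0 then ξ p.2 else 0).submatrix ε.symm id)
  have hsw : sandwich (Wᴴ.submatrix id ε.symm) Z
    ((Matrix.of fun (p : (Fin n × Fin n) × Fin m) (k : Fin n) =>
      if (k : ℕ) = 0 then ξ p.2 else 0).submatrix ε.symm id) =
      ((n * s : ℝ) : ℂ) • ∑ k : Fin n, tensor (colUnit k) (e k) := by
    ext l l'
    rw [sandwich_stacked ε hZ, Matrix.smul_apply, sum_tensor_colUnit_apply]
    split_ifs
    · simp only [hS, Finset.smul_sum, smul_smul]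
      rw [Finset.sum_comm]
      simp only [← Finset.sum_smul]
      have h2 : ∀ l' : Fin n, ∑ p, star (W p l) * W p l' =
          ((n * s : ℝ) : ℂ) * if l = l' then 1 else 0 := by
        intro l'
        have := congrFun (congrFun hWW l) l'
        rwa [Matrix.mul_apply, Matrix.smul_apply, Matrix.one_apply] at this
      simp only [h2, mul_ite, mul_one, mul_zero, ite_smul, zero_smul, Finset.sum_ite_eq,
        Finset.mem_univ, if_true]
    · simp
  rw [hsw, map_smul_eq_mul, Complex.norm_real, Real.norm_of_nonneg (by positivity)] at key
  have hα : ‖Wᴴ.submatrix id ε.symm‖ ≤ √(n * s) := by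
    refine (norm_reindex_le Wᴴ (Equiv.refl _) ε.symm).trans ?_
    rwa [Matrix.l2_opNorm_conjTranspose]
  have hβ := (norm_reindex_le (Matrix.of fun (p : (Fin n × Fin n) × Fin m) (k : Fin n) =>
      if (k : ℕ) = 0 then ξ p.2 else 0) ε.symm (Equiv.refl _)).trans (norm_const_column_le ξ)
  -- There are n² copies of ξ, whence the factor n.
  rw [Fintype.card_prod, Fintype.card_fin, Nat.cast_mul, ← sq, Real.sqrt_mul (sq_nonneg _),
    Real.sqrt_sq (Nat.cast_nonneg n)] at hβ
  set A := matNorm n (∑ k : Fin n, tensor (colUnit k) (e k)) with hA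
  have key2 : n * s * A ≤ √(n * s) * N * (n * √(∑ j, ‖ξ j‖ ^ 2)) := by
    refine key.trans ?_
    have hZ0 : 0 ≤ matNorm M Z := apply_nonneg _ _
    gcongr
    exact hβ
  have hn' : (0 : ℝ) < n := Nat.cast_pos.2 hn
  -- If s = 0 the left side vanishes; otherwise n√s is cancelled from `key2`.
  rcases eq_or_lt_of_le hs0 with h0 | h0
  · rw [← h0, Real.sqrt_zero, zero_mul]
    positivity
  · have hr := Real.sqrt_pos.2 h0
    have h3 : (0 : ℝ) < n * √s := by positivity
    refine le_of_mul_le_mul_left ?_ h3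
    rw [Real.sqrt_mul hn'.le] at key2
    calc n * √s * (√s * A) = n * (√s * √s) * A := by ring
      _ = n * s * A := by rw [Real.mul_self_sqrt hs0]
      _ ≤ _ := key2
      _ = _ := by ring

/-- After division by the column norm A of `e`, `sqrt_sum_mul_matNorm_le` says that L√n / A is a
cb-bound for the column of `f`. -/
theorem fundCol_mul_fundCol_le (T : H ≃L[ℂ] F) {lam : ℝ} (hlam : 0 ≤ lam)
    (hF : IsHomogeneousWith F lam) {e : ℕ → F} {f : ℕ → StrongDual ℂ F} {n : ℕ}
    (he : Orthonormal ℂ fun k : Fin n => T.symm (e k))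
    (hf : ∀ (k : Fin n) v, f k v = inner ℂ (T.symm (e k)) (T.symm v)) :
    fundCol e n * fundCol f n ≤
      (lam * (‖(T : H →L[ℂ] F)‖ * ‖(T.symm : F →L[ℂ] H)‖)) ^ 2 * n := by
  set L := lam * (‖(T : H →L[ℂ] F)‖ * ‖(T.symm : F →L[ℂ] H)‖) with hL
  have hL0 : 0 ≤ L := by positivity
  rw [fundCol, fundCol, ← mul_pow]
  set A := matNorm n (∑ k : Fin n, tensor (colUnit k) (e k)) with hA
  have hA0 : 0 ≤ A := apply_nonneg _ _
  set y := ∑ k : Fin n, tensor (colUnit k) (f k) with hy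
  have hB0 : 0 ≤ matNorm n y := apply_nonneg _ _
  suffices h : A * matNorm n y ≤ L * √n by
    calc _ ≤ (L * √n) ^ 2 := by gcongr
      _ = _ := by rw [mul_pow, Real.sq_sqrt (Nat.cast_nonneg n)]
  rcases eq_or_lt_of_le hA0 with h0 | h0
  · rw [← h0, zero_mul]; positivity
  rw [mul_comm, ← le_div_iff₀ h0]
  refine dualNorm_le ⟨by positivity, fun m x => ?_⟩
  have hx0 : 0 ≤ matNorm m x := apply_nonneg _ _
  refine norm_le_of_sq _ (by positivity) fun v => ?_
  rcases Nat.eq_zero_or_pos n with rfl | hn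
  · simp
  simp only [Fintype.sum_prod_type, hy, pairing_col_apply]
  have h := sqrt_sum_mul_matNorm_le T hlam hF he hf x fun j => v (⟨0, hn⟩, j)
  rw [← hA, ← hL, ← le_div_iff₀ h0] at h
  have h2 := Real.sqrt_le_left (by positivity) |>.1 h
  calc _ ≤ _ := h2
    _ = (L * √n / A * matNorm m x) ^ 2 * ∑ j, ‖v (⟨0, hn⟩, j)‖ ^ 2 := by
      rw [← Real.sq_sqrt (show 0 ≤ ∑ j, ‖v (⟨0, hn⟩, j)‖ ^ 2 by positivity)]
      rw [Real.sqrt_sq (Real.sqrt_nonneg _)]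
      ring
    _ ≤ _ := by
      gcongr
      exact Finset.single_le_sum (f := fun k => ∑ j, ‖v (k, j)‖ ^ 2) (fun _ _ => by positivity)
        (Finset.mem_univ _)

end transport

/-! ### The opposite operator space, exchanging rows and columns -/

section opposite

theorem directSum_transpose {F : Type*} [Zero F] {m n : ℕ} (x : Matrix (Fin m) (Fin m) F)
    (y : Matrix (Fin n) (Fin n) F) : (directSum x y)ᵀ = directSum xᵀ yᵀ := by
  simp [directSum, Matrix.fromBlocks_transpose, Matrix.transpose_submatrix]

variable {F : Type*} [NormedAddCommGroup F] [NormedSpace ℂ F]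

theorem sandwich_transpose {m n : ℕ} (α : Matrix (Fin n) (Fin m) ℂ) (x : Matrix (Fin m) (Fin m) F)
    (β : Matrix (Fin m) (Fin n) ℂ) : (sandwich α x β)ᵀ = sandwich βᵀ xᵀ αᵀ := by
  ext i j
  simp only [sandwich, Matrix.transpose_apply, Matrix.of_apply]
  rw [Finset.sum_comm]
  simp only [mul_comm]

/-- The opposite operator space: the norm of a matrix is the original norm of its transpose. -/
@[reducible] def opposite (S : OperatorSpace F) : OperatorSpace F where
  matNorm n := (S.matNorm n).comp (Matrix.transposeLinearEquiv (Fin n) (Fin n) ℂ F).toLinearMap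
  matNorm_one v := S.matNorm_one v
  matNorm_directSum x y := by
    have h := S.matNorm_directSum xᵀ yᵀ
    rwa [← directSum_transpose] at h
  matNorm_sandwich α x β := by
    have h := S.matNorm_sandwich βᵀ xᵀ αᵀ
    rw [← sandwich_transpose, norm_transpose, norm_transpose] at h
    calc _ ≤ ‖β‖ * S.matNorm _ xᵀ * ‖α‖ := h
      _ = ‖α‖ * S.matNorm _ xᵀ * ‖β‖ := by ring

theorem matNorm_opposite (S : OperatorSpace F) {n : ℕ} (x : Matrix (Fin n) (Fin n) F) :
    (opposite S).matNorm n x = S.matNorm n xᵀ := rfl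

theorem fundRow_eq (S : OperatorSpace F) (e : ℕ → F) (n : ℕ) :
    fundRow e n = @fundCol F _ _ (opposite S) e n := by
  rw [fundRow, sum_tensor_rowUnit]
  rfl

theorem isHomogeneousWith_opposite (S : OperatorSpace F) {lam : ℝ} (h : IsHomogeneousWith F lam) :
    @IsHomogeneousWith F _ _ (opposite S) lam :=
  fun T n x => h T n xᵀ

/-- Transposing f and x together transposes the scalar matrix of their pairing, which leaves its
operator norm unchanged. Hence the dual of the opposite is the opposite of the dual. -/
theorem dualNorm_opposite (S : OperatorSpace F) {n : ℕ}
    (f : Matrix (Fin n) (Fin n) (StrongDual ℂ F)) :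
    @dualNorm F _ _ (opposite S) n f = dualNorm fᵀ := by
  have h : ∀ {m : ℕ} (f : Matrix (Fin n) (Fin n) (StrongDual ℂ F)) (x : Matrix (Fin m) (Fin m) F),
      ‖pairing fᵀ xᵀ‖ = ‖pairing f x‖ := fun f x => norm_transpose (pairing f x)
  have hs : @cbBounds F _ _ (opposite S) n f = cbBounds fᵀ := by
    ext K
    refine and_congr_right fun _ => forall_congr' fun m => ⟨fun hK x => ?_, fun hK x => ?_⟩
    · have := hK xᵀ
      rwa [← h, matNorm_opposite, Matrix.transpose_transpose] at this
    · rw [← h]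
      exact hK xᵀ
  exact congrArg sInf hs

theorem fundRow_dual_eq (S : OperatorSpace F) (f : ℕ → StrongDual ℂ F) (n : ℕ) :
    fundRow f n = @fundCol _ _ _ (@instOperatorSpaceDual F _ _ (opposite S)) f n := by
  rw [fundRow, sum_tensor_rowUnit]
  exact congrArg (· ^ 2) (dualNorm_opposite S _).symm

end opposite

/-! ### Row versions and the exact product formula -/

section duality

variable {F : Type*} [NormedAddCommGroup F] [NormedSpace ℂ F] [S : OperatorSpace F]
  {H : Type*} [NormedAddCommGroup H] [InnerProductSpace ℂ H]

theorem fundRow_le_fundRow (T : H ≃L[ℂ] F) {lam : ℝ} (hlam : 0 ≤ lam)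
    (hF : IsHomogeneousWith F lam) {e g : ℕ → F} {n : ℕ}
    (he : Orthonormal ℂ fun k : Fin n => T.symm (e k))
    (hg : Orthonormal ℂ fun k : Fin n => T.symm (g k)) :
    fundRow g n ≤
      (lam * (‖(T : H →L[ℂ] F)‖ * ‖(T.symm : F →L[ℂ] H)‖)) ^ 2 * fundRow e n := by
  rw [fundRow_eq, fundRow_eq]
  exact @fundCol_le_fundCol _ _ _ _ _ _ (opposite S) T lam hlam (isHomogeneousWith_opposite S hF)
    e g n he hg

theorem le_fundRow_mul_fundRow (e : ℕ → F) (f : ℕ → StrongDual ℂ F) (n : ℕ)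
    (h : ∀ i j : Fin n, f i (e j) = if i = j then 1 else 0) :
    (n : ℝ) ≤ fundRow e n * fundRow f n := by
  rw [fundRow_eq, fundRow_dual_eq]
  exact @le_fundCol_mul_fundCol _ _ _ (opposite S) e f n h

theorem fundRow_mul_fundRow_le (T : H ≃L[ℂ] F) {lam : ℝ} (hlam : 0 ≤ lam)
    (hF : IsHomogeneousWith F lam) {e : ℕ → F} {f : ℕ → StrongDual ℂ F} {n : ℕ}
    (he : Orthonormal ℂ fun k : Fin n => T.symm (e k))
    (hf : ∀ (k : Fin n) v, f k v = inner ℂ (T.symm (e k)) (T.symm v)) :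
    fundRow e n * fundRow f n ≤
      (lam * (‖(T : H →L[ℂ] F)‖ * ‖(T.symm : F →L[ℂ] H)‖)) ^ 2 * n := by
  rw [fundRow_eq, fundRow_dual_eq]
  exact @fundCol_mul_fundCol_le _ _ _ _ _ _ (opposite S) T lam hlam
    (isHomogeneousWith_opposite S hF) e f n he hf

theorem fund_nonneg (e : ℕ → F) (n : ℕ) : 0 ≤ fundCol e n ∧ 0 ≤ fundRow e n :=
  ⟨sq_nonneg _, sq_nonneg _⟩

omit S in
theorem biorthogonal {T : H ≃L[ℂ] F} {e : ℕ → F} {f : ℕ → StrongDual ℂ F} {n : ℕ}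
    (he : Orthonormal ℂ fun k : Fin n => T.symm (e k))
    (hf : ∀ (k : Fin n) v, f k v = inner ℂ (T.symm (e k)) (T.symm v)) (i j : Fin n) :
    f i (e j) = if i = j then 1 else 0 := by
  rw [hf]
  exact orthonormal_iff_ite.1 he i j

/-- If `T` is an isometry, the products of the fundamental functions of dual systems are `n`, even
if the systems are related only up to a unitary. -/
theorem fund_mul_fund_eq (T : H ≃ₗᵢ[ℂ] F) (hF : IsHomogeneousWith F 1) {e g : ℕ → F}
    {f : ℕ → StrongDual ℂ F} {n : ℕ} (he : Orthonormal ℂ fun k : Fin n => T.symm (e k))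
    (hg : Orthonormal ℂ fun k : Fin n => T.symm (g k))
    (hf : ∀ (k : Fin n) v, f k v = inner ℂ (T.symm (g k)) (T.symm v)) :
    fundCol e n * fundCol f n = n ∧ fundRow e n * fundRow f n = n := by
  set T' := T.toContinuousLinearEquiv with hT'
  set L := (1 * (‖(T' : H →L[ℂ] F)‖ * ‖(T'.symm : F →L[ℂ] H)‖)) ^ 2 with hL
  have h1 : ‖(T' : H →L[ℂ] F)‖ ≤ 1 := T.toLinearIsometry.norm_toContinuousLinearMap_le
  have h2 : ‖(T'.symm : F →L[ℂ] H)‖ ≤ 1 := T.symm.toLinearIsometry.norm_toContinuousLinearMap_le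
  -- Only an inequality, since both operator norms are 0 on the zero space.
  have hL1 : L ≤ 1 := by
    rw [hL, one_mul]
    exact pow_le_one₀ (by positivity) (mul_le_one₀ h1 (norm_nonneg _) h2)
  have hle : ∀ {a b : ℝ}, 0 ≤ b → a ≤ L * b → a ≤ b := fun hb h =>
    h.trans (mul_le_of_le_one_left hb hL1)
  have hc : fundCol e n = fundCol g n := le_antisymm
    (hle (sq_nonneg _) (fundCol_le_fundCol T' zero_le_one hF hg he))
    (hle (sq_nonneg _) (fundCol_le_fundCol T' zero_le_one hF he hg))
  have hr : fundRow e n = fundRow g n := le_antisymm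
    (hle (sq_nonneg _) (fundRow_le_fundRow T' zero_le_one hF hg he))
    (hle (sq_nonneg _) (fundRow_le_fundRow T' zero_le_one hF he hg))
  rw [hc, hr]
  have hb := biorthogonal (T := T') hg hf
  exact ⟨le_antisymm (hle (Nat.cast_nonneg n) (fundCol_mul_fundCol_le T' zero_le_one hF hg hf))
      (le_fundCol_mul_fundCol g f n hb),
    le_antisymm (hle (Nat.cast_nonneg n) (fundRow_mul_fundRow_le T' zero_le_one hF hg hf))
      (le_fundRow_mul_fundRow g f n hb)⟩

end duality

/-! ### Duals of Hilbert spaces, preadjoints and dimension -/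

section dualHilbert

variable {H : Type*} [NormedAddCommGroup H] [InnerProductSpace ℂ H] [CompleteSpace H]

variable (H) in
/-- The dual of a Hilbert space is a Hilbert space. -/
@[reducible] def dualInnerProductSpace : InnerProductSpace ℂ (StrongDual ℂ H) where
  toNormedSpace := inferInstance
  -- The arguments are exchanged because the Riesz map is conjugate-linear.
  inner φ ψ :=
    inner ℂ ((InnerProductSpace.toDual ℂ H).symm ψ) ((InnerProductSpace.toDual ℂ H).symm φ)
  norm_sq_eq_re_inner φ := by
    rw [← norm_sq_eq_re_inner, LinearIsometryEquiv.norm_map]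
  conj_inner_symm φ ψ := inner_conj_symm _ _
  add_left φ ψ χ := by rw [map_add, inner_add_right]
  smul_left φ ψ c := by rw [LinearIsometryEquiv.map_smulₛₗ, inner_smul_right]

theorem inner_dual (φ ψ : StrongDual ℂ H) : (dualInnerProductSpace H).inner φ ψ =
    inner ℂ ((InnerProductSpace.toDual ℂ H).symm ψ) ((InnerProductSpace.toDual ℂ H).symm φ) := rfl

theorem inner_toDual_left (h : H) (φ : StrongDual ℂ H) :
    (dualInnerProductSpace H).inner (InnerProductSpace.toDual ℂ H h) φ = φ h := by
  rw [inner_dual, LinearIsometryEquiv.symm_apply_apply, InnerProductSpace.toDual_symm_apply]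

theorem orthonormal_dual_iff {ι : Type*} {φ : ι → StrongDual ℂ H} :
    @Orthonormal ℂ _ _ _ (dualInnerProductSpace H) ι φ ↔
      Orthonormal ℂ fun i => (InnerProductSpace.toDual ℂ H).symm (φ i) := by
  classical
  rw [@orthonormal_iff_ite ℂ _ _ _ (dualInnerProductSpace H), orthonormal_iff_ite, forall_comm]
  simp only [inner_dual, eq_comm]

theorem orthonormal_toDual_iff {ι : Type*} {h : ι → H} :
    @Orthonormal ℂ _ _ _ (dualInnerProductSpace H) ι (fun i => InnerProductSpace.toDual ℂ H (h i)) ↔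
      Orthonormal ℂ h := by
  simp [orthonormal_dual_iff]

variable {F : Type*} [NormedAddCommGroup F] [NormedSpace ℂ F]

/-- An isomorphism of a Hilbert space onto `F*` is the adjoint of one of `F` onto the dual Hilbert
space, if `F` is isomorphic to a Hilbert space. -/
theorem exists_predual_equiv {H' : Type*} [NormedAddCommGroup H'] [InnerProductSpace ℂ H']
    (T : H ≃L[ℂ] F) (T' : H' ≃L[ℂ] StrongDual ℂ F) :
    ∃ U : F ≃L[ℂ] StrongDual ℂ H', ∀ v h, U v h = T' h v := by
  -- Completeness is needed for the open mapping theorem behind `ofBijective`.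
  have : CompleteSpace F :=
    (completeSpace_congr (e := T.toEquiv) T.isUniformEmbedding).1 inferInstance
  let U : F →L[ℂ] StrongDual ℂ H' := (T' : H' →L[ℂ] StrongDual ℂ F).flip
  have hU : ∀ v h, U v h = T' h v := fun v h => rfl
  refine ⟨ContinuousLinearEquiv.ofBijective U ?_ ?_, hU⟩
  · refine LinearMap.ker_eq_bot'.2 fun v hv => ?_
    refine SeparatingDual.eq_zero_of_forall_dual_eq_zero (R := ℂ) fun φ => ?_
    rw [← T'.apply_symm_apply φ, ← hU]
    exact congrArg (fun ψ : StrongDual ℂ H' => ψ (T'.symm φ)) hv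
  · refine LinearMap.range_eq_top.2 fun φ => ?_
    -- Surjectivity is reflexivity: φ becomes an element of F**, is carried to H** by `T`, and two
    -- Riesz representations yield w in H; its image `T w` is the preimage sought.
    let Θ : StrongDual ℂ (StrongDual ℂ F) := φ ∘L (T'.symm : StrongDual ℂ F →L[ℂ] H')
    let _ := dualInnerProductSpace H
    let A : StrongDual ℂ H ≃L[ℂ] StrongDual ℂ F := T.arrowCongr (ContinuousLinearEquiv.refl ℂ ℂ)
    let Θ' : StrongDual ℂ (StrongDual ℂ H) := Θ ∘L (A : StrongDual ℂ H →L[ℂ] StrongDual ℂ F)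
    let ψ := (InnerProductSpace.toDual ℂ (StrongDual ℂ H)).symm Θ'
    let w := (InnerProductSpace.toDual ℂ H).symm ψ
    have hw : ∀ χ : StrongDual ℂ H, Θ' χ = χ w := by
      intro χ
      rw [← InnerProductSpace.toDual_symm_apply (𝕜 := ℂ) (x := χ) (y := Θ')]
      change inner ℂ ψ χ = _
      rw [← inner_toDual_left w χ]
      congr 1
      exact ((InnerProductSpace.toDual ℂ H).apply_symm_apply ψ).symm
    refine ⟨T w, ContinuousLinearMap.ext fun h => ?_⟩
    have h1 := hw (A.symm (T' h))
    have h2 : Θ' (A.symm (T' h)) = φ h := by simp [Θ', Θ]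
    rw [h2] at h1
    rw [h1]
    rfl

/-- The algebraic dimensions of F and F* may differ as cardinals, but they agree when F is
finite-dimensional and are both infinite otherwise. The second case holds because F embeds into the
dual of F*. -/
theorem natCast_lt_rank_dual_iff (n : ℕ) :
    (n : Cardinal) < Module.rank ℂ (StrongDual ℂ F) ↔ (n : Cardinal) < Module.rank ℂ F := by
  by_cases h : FiniteDimensional ℂ F
  · have e : Module.rank ℂ (StrongDual ℂ F) = Module.rank ℂ F := by
      rw [← (LinearMap.toContinuousLinearMap (𝕜 := ℂ) (E := F) (F' := ℂ)).rank_eq,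
        ← Module.finrank_eq_rank, ← Module.finrank_eq_rank]
      exact congrArg _ Subspace.dual_finrank_eq
    rw [e]
  · have h' : ¬ FiniteDimensional ℂ (StrongDual ℂ F) := by
      intro h1
      let ι : F →ₗ[ℂ] Module.Dual ℂ (StrongDual ℂ F) :=
        { toFun := fun v =>
            { toFun := fun φ => φ v
              map_add' := fun _ _ => rfl
              map_smul' := fun _ _ => rfl }
          map_add' := fun v w => LinearMap.ext fun φ => map_add φ v w
          map_smul' := fun c v => LinearMap.ext fun φ => map_smul φ c v }
      refine h (Module.Finite.of_injective ι fun v w hvw => ?_)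
      exact SeparatingDual.eq_iff_forall_dual_eq (R := ℂ) |>.2 fun φ => LinearMap.congr_fun hvw φ
    rw [FiniteDimensional, ← Module.rank_lt_aleph0_iff, not_lt] at h h'
    exact iff_of_true ((Cardinal.natCast_lt_aleph0).trans_le h')
      ((Cardinal.natCast_lt_aleph0).trans_le h)

theorem natCast_le_rank_dual_iff (n : ℕ) :
    (n : Cardinal) ≤ Module.rank ℂ (StrongDual ℂ F) ↔ (n : Cardinal) ≤ Module.rank ℂ F := by
  rcases n with _ | n
  · simp
  · simp only [Nat.cast_succ, ← Cardinal.succ_natCast]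
    rw [Order.succ_le_iff, Order.succ_le_iff]
    exact natCast_lt_rank_dual_iff n

end dualHilbert

/-! ### Transfer of power growth between F and F* -/

section regular

/-- If the product of two functions is comparable with `n` and one of them grows between two
powers, so does the other. -/
theorem power_growth_of_mul {Φ Ψ : ℕ → ℝ} {C c d α β : ℝ} (hC : 0 < C)
    (hc : 0 < c) (hd : 0 < d) {k n : ℕ} (hk : 1 ≤ k) (hkn : k ≤ n)
    (h0 : ∀ m, 0 ≤ Φ m ∧ 0 ≤ Ψ m)
    (hkl : k ≤ Φ k * Ψ k) (hku : Φ k * Ψ k ≤ C * k) (hnl : n ≤ Φ n * Ψ n)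
    (hnu : Φ n * Ψ n ≤ C * n)
    (h1 : c * ((n : ℝ) / k) ^ α ≤ Φ n / Φ k) (h2 : Φ n / Φ k ≤ d * ((n : ℝ) / k) ^ β) :
    (C * d)⁻¹ * ((n : ℝ) / k) ^ (1 - β) ≤ Ψ n / Ψ k ∧
      Ψ n / Ψ k ≤ C / c * ((n : ℝ) / k) ^ (1 - α) := by
  have hk0 : (0 : ℝ) < k := by exact_mod_cast hk
  have hn0 : (0 : ℝ) < n := by exact_mod_cast hk.trans hkn
  have hpos : ∀ m : ℕ, (0 : ℝ) < m → m ≤ Φ m * Ψ m → 0 < Φ m ∧ 0 < Ψ m := by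
    intro m hm h
    have h' := hm.trans_le h
    exact ⟨pos_of_mul_pos_left h' (h0 m).2, pos_of_mul_pos_right h' (h0 m).1⟩
  obtain ⟨ha, hp⟩ := hpos n hn0 hnl
  obtain ⟨hb, hq⟩ := hpos k hk0 hkl
  set x := (n : ℝ) / k with hx
  have hx0 : 0 < x := div_pos hn0 hk0
  have hα : 0 < x ^ α := Real.rpow_pos_of_pos hx0 _
  have hβ : 0 < x ^ β := Real.rpow_pos_of_pos hx0 _
  rw [Real.rpow_sub hx0, Real.rpow_sub hx0, Real.rpow_one]
  have hnx : (n : ℝ) = x * k := by rw [hx]; field_simp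
  -- The quotient of products lies between n/(Ck) and Cn/k, so a bound on Φ n / Φ k in one direction
  -- bounds Ψ n / Ψ k in the other.
  have e : Ψ n / Ψ k = (Φ n * Ψ n) / (Φ k * Ψ k) / (Φ n / Φ k) := by
    field_simp
  have hab : 0 < Φ n / Φ k := div_pos ha hb
  rw [e]
  constructor
  · rw [le_div_iff₀ hab]
    calc (C * d)⁻¹ * (x / x ^ β) * (Φ n / Φ k) ≤ (C * d)⁻¹ * (x / x ^ β) * (d * x ^ β) := by
          gcongr
      _ = n / (C * k) := by rw [hnx]; field_simp
      _ ≤ _ := by gcongr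
  · rw [div_le_iff₀ hab]
    calc Φ n * Ψ n / (Φ k * Ψ k) ≤ C * n / k := by gcongr
      _ = C / c * (x / x ^ α) * (c * x ^ α) := by rw [hnx]; field_simp
      _ ≤ _ := by gcongr

universe u

variable {F : Type u} [NormedAddCommGroup F] [NormedSpace ℂ F] [OperatorSpace F]

theorem IsHomogeneous.exists_nonneg (h : IsHomogeneous F) :
    ∃ lam : ℝ, 0 ≤ lam ∧ IsHomogeneousWith F lam := by
  obtain ⟨lam, hl⟩ := h
  refine ⟨max lam 0, le_max_right _ _, fun T n x => (hl T n x).trans ?_⟩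
  have hN : 0 ≤ OperatorSpace.matNorm n x := apply_nonneg _ _
  gcongr
  exact le_max_left _ _

/-- Dual systems have fundamental functions whose product is comparable with `n`. -/
theorem exists_fund_mul_fund_le {H : Type*} [NormedAddCommGroup H] [InnerProductSpace ℂ H]
    (T : H ≃L[ℂ] F) (hF : IsHomogeneous F) :
    ∃ C : ℝ, 0 < C ∧ ∀ (e : ℕ → F) (f : ℕ → StrongDual ℂ F) (n : ℕ),
      (Orthonormal ℂ fun k : Fin n => T.symm (e k)) →
      (∀ (k : Fin n) v, f k v = inner ℂ (T.symm (e k)) (T.symm v)) →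
      (n ≤ fundCol e n * fundCol f n ∧ fundCol e n * fundCol f n ≤ C * n) ∧
      (n ≤ fundRow e n * fundRow f n ∧ fundRow e n * fundRow f n ≤ C * n) := by
  obtain ⟨lam, hlam, hl⟩ := hF.exists_nonneg
  -- The maximum with 1 keeps the constant positive even if lam or the norms vanish.
  refine ⟨max 1 ((lam * (‖(T : H →L[ℂ] F)‖ * ‖(T.symm : F →L[ℂ] H)‖)) ^ 2),
    lt_max_of_lt_left one_pos, fun e f n he hf => ?_⟩
  have hb := biorthogonal he hf
  have hn : (0 : ℝ) ≤ n := Nat.cast_nonneg n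
  exact ⟨⟨le_fundCol_mul_fundCol e f n hb, (fundCol_mul_fundCol_le T hlam hl he hf).trans
      (mul_le_mul_of_nonneg_right (le_max_right _ _) hn)⟩,
    ⟨le_fundRow_mul_fundRow e f n hb, (fundRow_mul_fundRow_le T hlam hl he hf).trans
      (mul_le_mul_of_nonneg_right (le_max_right _ _) hn)⟩⟩

/-- Both fundamental functions of `e` grow between two powers with exponents in `(0, 1)`. -/
def HasPowerGrowth (e : ℕ → F) : Prop :=
  ∃ c d α β : ℝ, 0 < c ∧ 0 < d ∧ 0 < α ∧ α ≤ β ∧ β < 1 ∧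
    ∀ k n : ℕ, 1 ≤ k → k ≤ n → (n : Cardinal) ≤ Module.rank ℂ F →
      (c * ((n : ℝ) / k) ^ α ≤ fundCol e n / fundCol e k ∧
        fundCol e n / fundCol e k ≤ d * ((n : ℝ) / k) ^ β) ∧
      (c * ((n : ℝ) / k) ^ α ≤ fundRow e n / fundRow e k ∧
        fundRow e n / fundRow e k ≤ d * ((n : ℝ) / k) ^ β)

theorem HasPowerGrowth.of_mul {G : Type*} [NormedAddCommGroup G] [NormedSpace ℂ G]
    [OperatorSpace G] {e : ℕ → F} {f : ℕ → G} (h : HasPowerGrowth e)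
    (hr : ∀ n : ℕ, (n : Cardinal) ≤ Module.rank ℂ G → (n : Cardinal) ≤ Module.rank ℂ F)
    {C : ℝ} (hC : 0 < C) (hb : ∀ n : ℕ, (n : Cardinal) ≤ Module.rank ℂ G →
      (n ≤ fundCol e n * fundCol f n ∧ fundCol e n * fundCol f n ≤ C * n) ∧
      (n ≤ fundRow e n * fundRow f n ∧ fundRow e n * fundRow f n ≤ C * n)) :
    HasPowerGrowth f := by
  obtain ⟨c, d, α, β, hc, hd, hα, hαβ, hβ, hg⟩ := h
  refine ⟨(C * d)⁻¹, C / c, 1 - β, 1 - α, by positivity, by positivity, by linarith, by linarith,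
    by linarith, fun k n hk hkn hn => ?_⟩
  obtain ⟨⟨h1, h2⟩, h3, h4⟩ := hg k n hk hkn (hr n hn)
  obtain ⟨⟨n1, n2⟩, n3, n4⟩ := hb n hn
  obtain ⟨⟨k1, k2⟩, k3, k4⟩ := hb k ((Nat.cast_le.2 hkn).trans hn)
  exact ⟨power_growth_of_mul hC hc hd hk hkn
      (fun m => ⟨(fund_nonneg e m).1, (fund_nonneg f m).1⟩) k1 k2 n1 n2 h1 h2,
    power_growth_of_mul hC hc hd hk hkn
      (fun m => ⟨(fund_nonneg e m).2, (fund_nonneg f m).2⟩) k3 k4 n3 n4 h3 h4⟩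

/-- The first `n` terms of a system that is orthonormal as far as the dimension allows. -/
theorem orthonormal_fin {H : Type*} [NormedAddCommGroup H] [InnerProductSpace ℂ H] {r : Cardinal}
    {h : ℕ → H} (hh : Orthonormal ℂ fun k : {k : ℕ // (k : Cardinal) < r} => h k) {n : ℕ}
    (hn : (n : Cardinal) ≤ r) : Orthonormal ℂ fun k : Fin n => h k :=
  hh.comp (fun k : Fin n => ⟨k, (Nat.cast_lt.2 k.2).trans_le hn⟩)
    fun _ _ hij => Fin.ext (congrArg (fun k : {k : ℕ // (k : Cardinal) < r} => (k : ℕ)) hij)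

omit [OperatorSpace F] in
theorem orthonormal_rank_dual_iff {H : Type*} [NormedAddCommGroup H] [InnerProductSpace ℂ H]
    {h : ℕ → H} :
    (Orthonormal ℂ fun k : {k : ℕ // (k : Cardinal) < Module.rank ℂ (StrongDual ℂ F)} => h k) ↔
      Orthonormal ℂ fun k : {k : ℕ // (k : Cardinal) < Module.rank ℂ F} => h k :=
  ⟨fun hh => hh.comp (Subtype.map id fun _ => (natCast_lt_rank_dual_iff _).2)
      (Subtype.map_injective _ Function.injective_id),
    fun hh => hh.comp (Subtype.map id fun _ => (natCast_lt_rank_dual_iff _).1)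
      (Subtype.map_injective _ Function.injective_id)⟩

/-- The coordinate functionals of a system witnessing regularity are the image of an orthonormal
system of the dual Hilbert space under the adjoint of `T.symm`. -/
theorem IsRegular.dual (hF : IsHomogeneous F) (h : IsRegular F) :
    IsRegular (StrongDual ℂ F) := by
  obtain ⟨H, _, _, _, T, e, he, hg⟩ := h
  obtain ⟨C, hC, hb⟩ := exists_fund_mul_fund_le T hF
  let f : ℕ → StrongDual ℂ F := fun k =>
    InnerProductSpace.toDual ℂ H (T.symm (e k)) ∘L (T.symm : F →L[ℂ] H)
  let T' : StrongDual ℂ H ≃L[ℂ] StrongDual ℂ F := T.arrowCongr (ContinuousLinearEquiv.refl ℂ ℂ)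
  have hT' : ∀ k, T'.symm (f k) = InnerProductSpace.toDual ℂ H (T.symm (e k)) := fun k =>
    T'.symm_apply_eq.2 rfl
  refine ⟨StrongDual ℂ H, inferInstance, dualInnerProductSpace H, inferInstance, T', f, ?_,
    HasPowerGrowth.of_mul (e := e) hg (fun n => (natCast_le_rank_dual_iff n).1) hC
      fun n hn => hb e f n (orthonormal_fin (h := fun k => T.symm (e k)) he
        ((natCast_le_rank_dual_iff n).1 hn)) fun k v => rfl⟩
  let _ := dualInnerProductSpace H
  refine orthonormal_rank_dual_iff (h := fun k => T'.symm (f k)) |>.2 ?_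
  simp only [hT']
  exact orthonormal_toDual_iff.2 he

/-- Homogeneity is known for F only, so the argument for `IsRegular.dual` is not applied to F*.
Instead the preadjoint of T' gives a Hilbert space structure on F in which the given functionals are
coordinate functionals. -/
theorem IsRegular.of_dual (hF : IsHomogeneous F) (hH : IsHilbertian F)
    (h : IsRegular (StrongDual ℂ F)) : IsRegular F := by
  obtain ⟨H', _, _, _, T', f, hf, hg⟩ := h
  obtain ⟨_, H, _, _, _, T, _⟩ := hH
  obtain ⟨U, hU⟩ := exists_predual_equiv T T'
  let _ := dualInnerProductSpace H'
  let V : StrongDual ℂ H' ≃L[ℂ] F := U.symm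
  obtain ⟨C, hC, hb⟩ := exists_fund_mul_fund_le V hF
  let e : ℕ → F := fun k => V (InnerProductSpace.toDual ℂ H' (T'.symm (f k)))
  have he : ∀ k, V.symm (e k) = InnerProductSpace.toDual ℂ H' (T'.symm (f k)) := fun k =>
    V.symm_apply_apply _
  have ho : Orthonormal ℂ fun k : {k : ℕ // (k : Cardinal) < Module.rank ℂ F} =>
      V.symm (e k) := by
    simp only [he]
    exact orthonormal_toDual_iff.2
      (orthonormal_rank_dual_iff (h := fun k => T'.symm (f k)) |>.1 hf)
  refine ⟨StrongDual ℂ H', inferInstance, dualInnerProductSpace H', inferInstance, V, e, ho,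
    HasPowerGrowth.of_mul (e := f) hg (fun n => (natCast_le_rank_dual_iff n).2) hC
      fun n hn => ?_⟩
  rw [mul_comm (fundCol f n), mul_comm (fundRow f n)]
  refine hb e f n (orthonormal_fin (h := fun k => V.symm (e k)) ho hn) fun k v => ?_
  rw [he]
  refine Eq.trans ?_ (inner_toDual_left (T'.symm (f k)) (V.symm v)).symm
  change _ = U v _
  rw [hU, T'.apply_symm_apply]

omit [OperatorSpace F] in
/-- An orthonormal system of `F*` is the system of coordinate functionals of an orthonormal system
of `F`. -/
theorem exists_predual_orthonormal {H : Type*} [NormedAddCommGroup H] [InnerProductSpace ℂ H]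
    [CompleteSpace H] (T : H ≃ₗᵢ[ℂ] F) {f : ℕ → StrongDual ℂ F}
    (hf : IsOrthonormalIn (StrongDual ℂ F) f) :
    ∃ g : ℕ → F, (Orthonormal ℂ fun k : {k : ℕ // (k : Cardinal) < Module.rank ℂ F} =>
      T.symm (g k)) ∧ ∀ k v, f k v = inner ℂ (T.symm (g k)) (T.symm v) := by
  obtain ⟨H', _, _, _, T', hf⟩ := hf
  let φ : ℕ → StrongDual ℂ H := fun k => f k ∘L (T : H →L[ℂ] F)
  refine ⟨fun k => T ((InnerProductSpace.toDual ℂ H).symm (φ k)), ?_, fun k v => ?_⟩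
  · simp only [LinearIsometryEquiv.symm_apply_apply]
    refine orthonormal_dual_iff.1 ?_
    let _ := dualInnerProductSpace H
    -- Composition with the isometry `T` identifies F* with H* isometrically, so the functionals of
    -- `f`, pulled back to H, are orthonormal in H*.
    let L : H' →ₗᵢ[ℂ] StrongDual ℂ H :=
      { toFun := fun h => T' h ∘L (T : H →L[ℂ] F)
        map_add' := fun a b => by rw [map_add, ContinuousLinearMap.add_comp]
        map_smul' := fun c a => by
          rw [map_smul, ContinuousLinearMap.smul_comp]; rfl
        norm_map' := fun a => by
          refine Eq.trans ?_ (T'.norm_map a)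
          exact ContinuousLinearMap.opNorm_comp_linearIsometryEquiv (T' a) T }
    have h := (orthonormal_rank_dual_iff (h := fun k => T'.symm (f k)) |>.1 hf).comp_linearIsometry
      L
    refine Eq.mp (congrArg _ (funext fun k => ?_)) h
    change T' (T'.symm (f k)) ∘L (T : H →L[ℂ] F) = _
    rw [T'.apply_symm_apply]
  · rw [LinearIsometryEquiv.symm_apply_apply, InnerProductSpace.toDual_symm_apply]
    simp [φ]

end regular

end OpSpace
end

theorem theorem3p11 {F : Type*} [NormedAddCommGroup F] [NormedSpace ℂ F]
    [OpSpace.OperatorSpace F] :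
    (OpSpace.IsHomogeneousWith F 1 → OpSpace.IsHilbertianWith F 1 →
      ∀ (e : ℕ → F) (f : ℕ → StrongDual ℂ F),
        OpSpace.IsOrthonormalIn F e → OpSpace.IsOrthonormalIn (StrongDual ℂ F) f →
        ∀ n : ℕ, (n : Cardinal) ≤ Module.rank ℂ F →
          OpSpace.fundCol e n * OpSpace.fundCol f n = n ∧
          OpSpace.fundRow e n * OpSpace.fundRow f n = n) ∧
    (OpSpace.IsHomogeneous F → OpSpace.IsHilbertian F →
      (OpSpace.IsRegular F ↔ OpSpace.IsRegular (StrongDual ℂ F))) := by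
  refine ⟨fun hF _ e f he hf n hn => ?_, fun hF hH => ⟨.dual hF, .of_dual hF hH⟩⟩
  obtain ⟨H, _, _, _, T, he⟩ := he
  obtain ⟨g, hg, hfg⟩ := OpSpace.exists_predual_orthonormal T hf
  exact OpSpace.fund_mul_fund_eq T hF (OpSpace.orthonormal_fin (h := fun k => T.symm (e k)) he hn)
    (OpSpace.orthonormal_fin (h := fun k => T.symm (g k)) hg hn) fun k => hfg k
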